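/- Let $C^\infty(S^1)$ be the algebra of smooth real functions of the angular coordinate $x\in\mathbb{R}/2\pi\mathbb{Z}$, let $F'=\partial_xF$, and let $C^\infty(S^{1|2})$ be the superspace of functions $F=f_0+f_1\theta_1+f_2\theta_2+f_{12}\theta_1\theta_2$ with $f_0,f_1,f_2,f_{12}\in C^\infty(S^1)$ and $\theta_1,\theta_2$ odd; $p(F)$ denotes the parity of $F$ (formulas containing $p(F)$ are stated for homogeneous $F$ and extended linearly). Put $\eta_k=\partial_{\theta_k}-\theta_k\partial_x$ and $\bar\eta_k=\partial_{\theta_k}+\theta_k\partial_x$, and let $\mathcal{K}(2)$ be the Lie superalgebra of contact vector fields $$v_F=F\partial_x+\tfrac{(-1)^{p(F)+1}}{2}\sum_{k=1}^2\eta_k(F)\eta_k,\qquad [v_F,v_G]=v_{\{F,G\}},\qquad \{F,G\}=FG'-F'G+\tfrac{(-1)^{p(F)+1}}{2}\sum_{k=1}^2\eta_k(F)\eta_k(G).$$ For $i=1,2$ let $\mathcal{K}(1)_i\subset\mathcal{K}(2)$ be the subalgebra of the $v_F$ with $F=f_0+f_i\theta_i$. For $\lambda\in\mathbb{R}$ let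 $\mathfrak{F}_\lambda$ be the superspace $C^\infty(S^{1|2})$ with the action $v_F\cdot G=v_F(G)+\lambda F'G$. For $b\in\mathbb{Z}/2$ let $Z^1_b$ be the space of $\mathbb{R}$-linear maps $c:\mathcal{K}(1)_i\to\mathfrak{F}_\lambda$ of parity $b$ (that is, taking elements of parity $a$ to elements of parity $a+b$) such that $c([g,h])=g\cdot c(h)-(-1)^{p(g)p(h)}\,h\cdot c(g)$ for all homogeneous $g,h\in\mathcal{K}(1)_i$, and let $H^1(\mathcal{K}(1)_i,\mathfrak{F}_\lambda)_b$ be the quotient of $Z^1_b$ by its subspace of maps of the form $g\mapsto g\cdot m$ with $m\in\mathfrak{F}_\lambda$. Then, for $i=1,2$ and all $\lambda\in\mathbb{R}$: 1) $$H^1(\mathcal{K}(1)_i,\mathfrak{F}_\lambda)_0\simeq\begin{cases}\mathbb{R}^3&\text{if }\lambda=0,\\ \mathbb{R}&\text{if }\lambda=1,\\ 0&\text{otherwise.}\end{cases}$$ A basis is given by the classes of the 1-cocycles $$C_0(v_F)=\tfrac14\big(3F+(-1)^{p(F)}F\big),\quad C_1(v_F)=F',\quad C_2(v_F)=\bar\eta_i(F')\theta_{3-i}\qquad\text{if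 }\lambda=0,$$ $$C_3(v_F)=\bar\eta_i(F'')\theta_{3-i}\qquad\text{if }\lambda=1.$$ 2) $$H^1(\mathcal{K}(1)_i,\mathfrak{F}_\lambda)_1\simeq\begin{cases}\mathbb{R}&\text{if }\lambda=\tfrac12\text{ or }\lambda=\tfrac32,\\ \mathbb{R}^2&\text{if }\lambda=-\tfrac12,\\ 0&\text{otherwise.}\end{cases}$$ A basis is given by the classes of the 1-cocycles $$C_4(v_F)=\tfrac14\big(3F+(-1)^{p(F)}F\big)\theta_{3-i},\quad C_5(v_F)=F'\theta_{3-i}\qquad\text{if }\lambda=-\tfrac12,$$ $$C_6(v_F)=\bar\eta_i(F')\quad\text{if }\lambda=\tfrac12,\qquad C_7(v_F)=\bar\eta_i(F'')\quad\text{if }\lambda=\tfrac32.$$ -/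

import Mathlib

noncomputable section

open scoped ContDiff

/-- `C^∞(S¹)`: smooth real functions of the angular coordinate `x ∈ ℝ / 2πℤ`, that is, smooth
`2π`-periodic functions on `ℝ`. -/
def smoothCircle : Subalgebra ℝ (ℝ → ℝ) where
  carrier := {f | ContDiff ℝ ∞ f ∧ Function.Periodic f (2 * Real.pi)}
  mul_mem' ha hb := ⟨ha.1.mul hb.1, ha.2.mul hb.2⟩
  add_mem' ha hb := ⟨ha.1.add hb.1, ha.2.add hb.2⟩
  algebraMap_mem' _ := ⟨contDiff_const, fun _ => rfl⟩

/-- The ring `C^∞(S¹)`. -/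
def CircleFun : Type := smoothCircle

instance : CommRing CircleFun := inferInstanceAs (CommRing smoothCircle)
instance : Algebra ℝ CircleFun := inferInstanceAs (Algebra ℝ smoothCircle)
instance : CoeFun CircleFun fun _ => ℝ → ℝ := ⟨fun f => f.val⟩

namespace CircleFun

protected theorem differentiable (f : CircleFun) : Differentiable ℝ (f : ℝ → ℝ) :=
  ContDiff.differentiable f.property.1 (by simp)

theorem deriv_mem (f : CircleFun) : deriv (f : ℝ → ℝ) ∈ smoothCircle := by
  refine ⟨(contDiff_infty_iff_deriv.1 f.property.1).2, fun x => ?_⟩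
  have h : (fun y => f (y + 2 * Real.pi)) = f := funext f.property.2
  rw [← deriv_comp_add_const, h]

end CircleFun

/-- The derivation `f ↦ f'` of `C^∞(S¹)`. -/
def circleDeriv : Derivation ℝ CircleFun CircleFun :=
  Derivation.mk'
    { toFun := fun f => (⟨deriv (f : ℝ → ℝ), f.deriv_mem⟩ : smoothCircle)
      map_add' := fun f g => Subtype.ext <| funext fun x =>
        deriv_add (f.differentiable x) (g.differentiable x)
      map_smul' := fun r f => Subtype.ext <| funext fun x =>
        deriv_const_smul r (f.differentiable x) }
    (fun f g => Subtype.ext <| funext fun x => by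
      have h := deriv_mul (f.differentiable x) (g.differentiable x)
      change deriv ((f : ℝ → ℝ) * (g : ℝ → ℝ)) x = f x * deriv g x + g x * deriv f x
      rw [h]; ring)

/-- `C^∞(S^{1|2})`: the superfunction `f₀ + f₁ θ₁ + f₂ θ₂ + f₁₂ θ₁ θ₂` with coefficients in
`C^∞(S¹)`. The odd variables `θ₁`, `θ₂` anticommute and square to zero. -/
@[ext]
structure SuperFun where
  f₀ : CircleFun
  f₁ : CircleFun
  f₂ : CircleFun
  f₁₂ : CircleFun

namespace SuperFun

instance : Zero SuperFun := ⟨⟨0, 0, 0, 0⟩⟩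
instance : Add SuperFun := ⟨fun F G => ⟨F.f₀ + G.f₀, F.f₁ + G.f₁, F.f₂ + G.f₂, F.f₁₂ + G.f₁₂⟩⟩
instance : Neg SuperFun := ⟨fun F => ⟨-F.f₀, -F.f₁, -F.f₂, -F.f₁₂⟩⟩
instance : Sub SuperFun := ⟨fun F G => ⟨F.f₀ - G.f₀, F.f₁ - G.f₁, F.f₂ - G.f₂, F.f₁₂ - G.f₁₂⟩⟩
instance : SMul ℝ SuperFun := ⟨fun r F => ⟨r • F.f₀, r • F.f₁, r • F.f₂, r • F.f₁₂⟩⟩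

/-- The product of superfunctions, determined by `θ₁ θ₂ = - θ₂ θ₁` and `θ₁² = θ₂² = 0`. -/
instance : Mul SuperFun :=
  ⟨fun F G =>
    ⟨F.f₀ * G.f₀,
     F.f₀ * G.f₁ + F.f₁ * G.f₀,
     F.f₀ * G.f₂ + F.f₂ * G.f₀,
     F.f₀ * G.f₁₂ + F.f₁₂ * G.f₀ + F.f₁ * G.f₂ - F.f₂ * G.f₁⟩⟩

@[simp] theorem zero_f₀ : (0 : SuperFun).f₀ = 0 := rfl
@[simp] theorem zero_f₁ : (0 : SuperFun).f₁ = 0 := rfl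
@[simp] theorem zero_f₂ : (0 : SuperFun).f₂ = 0 := rfl
@[simp] theorem zero_f₁₂ : (0 : SuperFun).f₁₂ = 0 := rfl
@[simp] theorem add_f₀ (F G : SuperFun) : (F + G).f₀ = F.f₀ + G.f₀ := rfl
@[simp] theorem add_f₁ (F G : SuperFun) : (F + G).f₁ = F.f₁ + G.f₁ := rfl
@[simp] theorem add_f₂ (F G : SuperFun) : (F + G).f₂ = F.f₂ + G.f₂ := rfl
@[simp] theorem add_f₁₂ (F G : SuperFun) : (F + G).f₁₂ = F.f₁₂ + G.f₁₂ := rfl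
@[simp] theorem neg_f₀ (F : SuperFun) : (-F).f₀ = -F.f₀ := rfl
@[simp] theorem neg_f₁ (F : SuperFun) : (-F).f₁ = -F.f₁ := rfl
@[simp] theorem neg_f₂ (F : SuperFun) : (-F).f₂ = -F.f₂ := rfl
@[simp] theorem neg_f₁₂ (F : SuperFun) : (-F).f₁₂ = -F.f₁₂ := rfl
@[simp] theorem sub_f₀ (F G : SuperFun) : (F - G).f₀ = F.f₀ - G.f₀ := rfl
@[simp] theorem sub_f₁ (F G : SuperFun) : (F - G).f₁ = F.f₁ - G.f₁ := rfl
@[simp] theorem sub_f₂ (F G : SuperFun) : (F - G).f₂ = F.f₂ - G.f₂ := rfl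
@[simp] theorem sub_f₁₂ (F G : SuperFun) : (F - G).f₁₂ = F.f₁₂ - G.f₁₂ := rfl
@[simp] theorem smul_f₀ (r : ℝ) (F : SuperFun) : (r • F).f₀ = r • F.f₀ := rfl
@[simp] theorem smul_f₁ (r : ℝ) (F : SuperFun) : (r • F).f₁ = r • F.f₁ := rfl
@[simp] theorem smul_f₂ (r : ℝ) (F : SuperFun) : (r • F).f₂ = r • F.f₂ := rfl
@[simp] theorem smul_f₁₂ (r : ℝ) (F : SuperFun) : (r • F).f₁₂ = r • F.f₁₂ := rfl
@[simp] theorem mul_f₀ (F G : SuperFun) : (F * G).f₀ = F.f₀ * G.f₀ := rfl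
@[simp] theorem mul_f₁ (F G : SuperFun) : (F * G).f₁ = F.f₀ * G.f₁ + F.f₁ * G.f₀ := rfl
@[simp] theorem mul_f₂ (F G : SuperFun) : (F * G).f₂ = F.f₀ * G.f₂ + F.f₂ * G.f₀ := rfl
@[simp] theorem mul_f₁₂ (F G : SuperFun) : (F * G).f₁₂ =
    F.f₀ * G.f₁₂ + F.f₁₂ * G.f₀ + F.f₁ * G.f₂ - F.f₂ * G.f₁ := rfl

instance : AddCommGroup SuperFun where
  add_assoc F G H := by ext1 <;> simp [add_assoc]
  zero_add F := by ext1 <;> simp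
  add_zero F := by ext1 <;> simp
  add_comm F G := by ext1 <;> simp [add_comm]
  neg_add_cancel F := by ext1 <;> simp
  sub_eq_add_neg F G := by ext1 <;> simp [sub_eq_add_neg]
  nsmul := nsmulRec
  zsmul := zsmulRec

instance : Module ℝ SuperFun where
  one_smul F := by ext1 <;> simp
  mul_smul r s F := by ext1 <;> simp [mul_smul]
  smul_zero r := by ext1 <;> simp
  smul_add r F G := by ext1 <;> simp
  add_smul r s F := by ext1 <;> simp [add_smul]
  zero_smul F := by ext1 <;> simp

/-- The odd coordinates: `theta 0` is `θ₁` and `theta 1` is `θ₂`. -/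
def theta : Fin 2 → SuperFun
  | 0 => ⟨0, 1, 0, 0⟩
  | 1 => ⟨0, 0, 1, 0⟩

/-- The even derivation `∂ₓ`, written `F ↦ F'`. -/
def dx (F : SuperFun) : SuperFun :=
  ⟨circleDeriv F.f₀, circleDeriv F.f₁, circleDeriv F.f₂, circleDeriv F.f₁₂⟩

/-- The odd left derivations `∂_{θ₁}` and `∂_{θ₂}`. -/
def dtheta : Fin 2 → SuperFun → SuperFun
  | 0, F => ⟨F.f₁, 0, F.f₁₂, 0⟩
  | 1, F => ⟨F.f₂, -F.f₁₂, 0, 0⟩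

/-- `ηᵢ = ∂_{θᵢ} - θᵢ ∂ₓ`. -/
def eta (i : Fin 2) (F : SuperFun) : SuperFun := dtheta i F - theta i * dx F

/-- `η̄ᵢ = ∂_{θᵢ} + θᵢ ∂ₓ`. -/
def etaBar (i : Fin 2) (F : SuperFun) : SuperFun := dtheta i F + theta i * dx F

/-- The linear map equal to `F ↦ (-1)^{p(F)} F` on homogeneous `F`. -/
def signed (F : SuperFun) : SuperFun := ⟨F.f₀, -F.f₁, -F.f₂, F.f₁₂⟩

/-- The superfunctions of parity `p`. -/
def parity (p : ZMod 2) : Submodule ℝ SuperFun where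
  carrier := {F | (p = 0 → F.f₁ = 0 ∧ F.f₂ = 0) ∧ (p = 1 → F.f₀ = 0 ∧ F.f₁₂ = 0)}
  add_mem' := by
    rintro F G ⟨h, h'⟩ ⟨k, k'⟩
    exact ⟨fun hp => by simp [h hp, k hp], fun hp => by simp [h' hp, k' hp]⟩
  zero_mem' := by simp
  smul_mem' := by
    rintro r F ⟨h, h'⟩
    exact ⟨fun hp => by simp [h hp], fun hp => by simp [h' hp]⟩

/-- The contact vector field `v_F = F ∂ₓ + (-1)^{p(F)+1}/2 ∑ᵢ ηᵢ(F) ηᵢ` applied to `G`. -/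
def contactField (F G : SuperFun) : SuperFun :=
  F * dx G - (1 / 2 : ℝ) • ∑ k : Fin 2, eta k (signed F) * eta k G

/-- The contact bracket `{F, G} = F G' - F' G + (-1)^{p(F)+1}/2 ∑ᵢ ηᵢ(F) ηᵢ(G)`. -/
def contactBracket (F G : SuperFun) : SuperFun :=
  F * dx G - dx F * G - (1 / 2 : ℝ) • ∑ k : Fin 2, eta k (signed F) * eta k G

/-- The action of `v_F` on densities of weight `lam`: `v_F(G) + lam F' G`. The module of densities
of weight `lam` is the superspace `SuperFun` with this action. -/
def lieDensity (lam : ℝ) (F G : SuperFun) : SuperFun :=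
  contactField F G + lam • (dx F * G)

@[simp] theorem dx_f₀ (F : SuperFun) : (dx F).f₀ = circleDeriv F.f₀ := rfl
@[simp] theorem dx_f₁ (F : SuperFun) : (dx F).f₁ = circleDeriv F.f₁ := rfl
@[simp] theorem dx_f₂ (F : SuperFun) : (dx F).f₂ = circleDeriv F.f₂ := rfl
@[simp] theorem dx_f₁₂ (F : SuperFun) : (dx F).f₁₂ = circleDeriv F.f₁₂ := rfl

theorem dx_add (F G : SuperFun) : dx (F + G) = dx F + dx G := by
  ext1 <;> simp

theorem dx_smul (r : ℝ) (F : SuperFun) : dx (r • F) = r • dx F := by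
  ext1 <;> simp

theorem eta_zero (F : SuperFun) :
    eta 0 F = ⟨F.f₁, -circleDeriv F.f₀, F.f₁₂, -circleDeriv F.f₂⟩ := by
  ext1 <;> simp [eta, dtheta, theta]

theorem eta_one (F : SuperFun) :
    eta 1 F = ⟨F.f₂, -F.f₁₂, -circleDeriv F.f₀, circleDeriv F.f₁⟩ := by
  ext1 <;> simp [eta, dtheta, theta]

theorem etaBar_zero (F : SuperFun) :
    etaBar 0 F = ⟨F.f₁, circleDeriv F.f₀, F.f₁₂, circleDeriv F.f₂⟩ := by
  ext1 <;> simp [etaBar, dtheta, theta]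

theorem etaBar_one (F : SuperFun) :
    etaBar 1 F = ⟨F.f₂, -F.f₁₂, circleDeriv F.f₀, -circleDeriv F.f₁⟩ := by
  ext1 <;> simp [etaBar, dtheta, theta]

@[simp] theorem signed_f₀ (F : SuperFun) : (signed F).f₀ = F.f₀ := rfl
@[simp] theorem signed_f₁ (F : SuperFun) : (signed F).f₁ = -F.f₁ := rfl
@[simp] theorem signed_f₂ (F : SuperFun) : (signed F).f₂ = -F.f₂ := rfl
@[simp] theorem signed_f₁₂ (F : SuperFun) : (signed F).f₁₂ = F.f₁₂ := rfl

theorem etaBar_add (i : Fin 2) (F G : SuperFun) : etaBar i (F + G) = etaBar i F + etaBar i G := by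
  fin_cases i <;> ext1 <;> simp [etaBar_zero, etaBar_one] <;> ring

theorem etaBar_smul (i : Fin 2) (r : ℝ) (F : SuperFun) : etaBar i (r • F) = r • etaBar i F := by
  fin_cases i <;> ext1 <;> simp [etaBar_zero, etaBar_one]

theorem signed_add (F G : SuperFun) : signed (F + G) = signed F + signed G := by
  ext1 <;> simp <;> ring

theorem signed_smul (r : ℝ) (F : SuperFun) : signed (r • F) = r • signed F := by
  ext1 <;> simp

protected theorem add_mul (F G H : SuperFun) : (F + G) * H = F * H + G * H := by
  ext1 <;> simp <;> ring

protected theorem smul_mul (r : ℝ) (F G : SuperFun) : (r • F) * G = r • (F * G) := by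
  ext1 <;> simp [smul_add, smul_sub]

theorem lieDensity_add_left (lam : ℝ) (F G H : SuperFun) :
    lieDensity lam (F + G) H = lieDensity lam F H + lieDensity lam G H := by
  ext1 <;> simp [lieDensity, contactField, eta_zero, eta_one, Fin.sum_univ_two, Algebra.smul_def] <;>
    ring

theorem lieDensity_add_right (lam : ℝ) (F G H : SuperFun) :
    lieDensity lam F (G + H) = lieDensity lam F G + lieDensity lam F H := by
  ext1 <;> simp [lieDensity, contactField, eta_zero, eta_one, Fin.sum_univ_two, Algebra.smul_def] <;>
    ring

theorem lieDensity_smul_right (lam r : ℝ) (F G : SuperFun) :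
    lieDensity lam F (r • G) = r • lieDensity lam F G := by
  ext1 <;> simp [lieDensity, contactField, eta_zero, eta_one, Fin.sum_univ_two, Algebra.smul_def] <;>
    ring

theorem circleDeriv_mul (f g : CircleFun) :
    circleDeriv (f * g) = f * circleDeriv g + g * circleDeriv f := circleDeriv.leibniz f g

/-- The constant function `1 / 2`. -/
def halfFun : CircleFun := algebraMap ℝ CircleFun (1 / 2)

theorem halfFun_two : 2 * halfFun = 1 := by
  rw [halfFun, ← map_ofNat (algebraMap ℝ CircleFun) 2, ← map_mul]; norm_num

theorem circleDeriv_halfFun : circleDeriv halfFun = 0 := circleDeriv.map_algebraMap _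

theorem contactField_eq (F G : SuperFun) : contactField F G =
    ⟨F.f₀ * circleDeriv G.f₀ + halfFun * (F.f₁ * G.f₁ + F.f₂ * G.f₂),
     F.f₀ * circleDeriv G.f₁ + halfFun * (F.f₁ * circleDeriv G.f₀ + circleDeriv F.f₀ * G.f₁
       - F.f₂ * G.f₁₂ + F.f₁₂ * G.f₂),
     F.f₀ * circleDeriv G.f₂ + halfFun * (F.f₂ * circleDeriv G.f₀ + circleDeriv F.f₀ * G.f₂
       + F.f₁ * G.f₁₂ - F.f₁₂ * G.f₁),
     F.f₀ * circleDeriv G.f₁₂ + circleDeriv F.f₀ * G.f₁₂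
       + halfFun * (F.f₁ * circleDeriv G.f₂ - F.f₂ * circleDeriv G.f₁
         - circleDeriv F.f₂ * G.f₁ + circleDeriv F.f₁ * G.f₂)⟩ := by
  have hh := halfFun_two
  ext1 <;>
    simp only [contactField, eta_zero, eta_one, Fin.sum_univ_two, sub_f₀, smul_f₀, add_f₀, mul_f₀, dx_f₀, signed_f₀, signed_f₁, signed_f₂, signed_f₁₂, sub_f₁, smul_f₁, add_f₁, mul_f₁, dx_f₁, sub_f₂, smul_f₂, add_f₂, mul_f₂, dx_f₂, sub_f₁₂, smul_f₁₂, add_f₁₂, mul_f₁₂, dx_f₁₂, map_neg, Algebra.smul_def] <;>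
    rw [show algebraMap ℝ CircleFun (1 / 2) = halfFun from rfl] <;>
    generalize halfFun = e at hh ⊢
  · ring
  · linear_combination (F.f₁ * circleDeriv G.f₀) * (-hh)
  · linear_combination (F.f₂ * circleDeriv G.f₀) * (-hh)
  · linear_combination (-F.f₁₂ * circleDeriv G.f₀ + circleDeriv F.f₀ * G.f₁₂ - F.f₁ * circleDeriv G.f₂ + F.f₂ * circleDeriv G.f₁) * hh

theorem contactBracket_eq (F G : SuperFun) :
    contactBracket F G = contactField F G - dx F * G := by
  simp only [contactBracket, contactField]; abel

/-- `𝔉_lam` is a module: on homogeneous elements, `v_{F,G}` acts as the supercommutator of the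
actions of `v_F` and `v_G`. -/
theorem lieDensity_contactBracket (lam : ℝ) (p q : ZMod 2) (F G H : SuperFun) (hF : F ∈ parity p)
    (hG : G ∈ parity q) :
    lieDensity lam (contactBracket F G) H = lieDensity lam F (lieDensity lam G H)
      - (-1 : ℝ) ^ (p.val * q.val) • lieDensity lam G (lieDensity lam F H) := by
  have hh := halfFun_two
  have hd := circleDeriv_halfFun
  have hl : circleDeriv (algebraMap ℝ CircleFun lam) = 0 := circleDeriv.map_algebraMap _
  have e0 : (-1 : ℝ) ^ ((0 : ZMod 2).val * (0 : ZMod 2).val) = 1 := by simp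
  have e1 : (-1 : ℝ) ^ ((0 : ZMod 2).val * (1 : ZMod 2).val) = 1 := by simp
  have e2 : (-1 : ℝ) ^ ((1 : ZMod 2).val * (0 : ZMod 2).val) = 1 := by simp
  have e3 : (-1 : ℝ) ^ ((1 : ZMod 2).val * (1 : ZMod 2).val) = -1 := by
    rw [show (1 : ZMod 2).val = 1 from rfl]; simp
  have hz : ∀ r : ZMod 2, r = 0 ∨ r = 1 := by decide
  obtain ⟨a, b⟩ := hF
  obtain ⟨a', b'⟩ := hG
  cases F; cases G; cases H
  obtain rfl | rfl : p = 0 ∨ p = 1 := hz p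
  all_goals obtain rfl | rfl : q = 0 ∨ q = 1 := hz q
  all_goals
    first
      | obtain ⟨rfl, rfl⟩ := a rfl
      | obtain ⟨rfl, rfl⟩ := b rfl
    first
      | obtain ⟨rfl, rfl⟩ := a' rfl
      | obtain ⟨rfl, rfl⟩ := b' rfl
    clear a b a' b'
    simp only [e0, e1, e2, e3, neg_one_smul, one_smul, sub_neg_eq_add]
    clear e0 e1 e2 e3
    ext1
  all_goals
    simp only [lieDensity, contactBracket_eq, contactField_eq, sub_f₀, smul_f₀, add_f₀, mul_f₀,
      dx_f₀, sub_f₁, smul_f₁, add_f₁, mul_f₁, dx_f₁, sub_f₂, smul_f₂, add_f₂, mul_f₂, dx_f₂,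
      sub_f₁₂, smul_f₁₂, add_f₁₂, mul_f₁₂, dx_f₁₂, Algebra.smul_def, map_add, map_sub, map_zero,
      circleDeriv_mul, hd, hl, mul_zero, zero_mul, add_zero, zero_add, sub_zero]
    generalize algebraMap ℝ CircleFun lam = l
    generalize halfFun = e at hh ⊢
  all_goals first | ring1 | grind

/-- A contact vector field determines its contact Hamiltonian. -/
theorem contactField_injective : Function.Injective contactField := by
  intro F G h
  have h1 := congrFun h (theta 0)
  have h2 := congrFun h (theta 1)
  have h3 := congrFun h ⟨(⟨Real.sin, Real.contDiff_sin, Real.sin_periodic⟩ : smoothCircle), 0, 0, 0⟩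
  have h4 := congrFun h ⟨(⟨Real.cos, Real.contDiff_cos, Real.cos_periodic⟩ : smoothCircle), 0, 0, 0⟩
  simp only [contactField, eta_zero, eta_one, Fin.sum_univ_two, theta] at h1 h2
  simp [SuperFun.ext_iff] at h1 h2
  rw [contactField_eq, contactField_eq] at h3 h4
  have h5 := congrArg SuperFun.f₀ h3
  have h6 := congrArg SuperFun.f₀ h4
  simp only [mul_zero, add_zero] at h5 h6
  refine SuperFun.ext (Subtype.ext (funext fun x => ?_)) h1.1 h2.1 h1.2.2.1
  have h7 : F.f₀ x * deriv Real.sin x = G.f₀ x * deriv Real.sin x :=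
    congrFun (congrArg Subtype.val h5) x
  have h8 : F.f₀ x * deriv Real.cos x = G.f₀ x * deriv Real.cos x :=
    congrFun (congrArg Subtype.val h6) x
  rw [Real.deriv_sin] at h7
  rw [Real.deriv_cos'] at h8
  linear_combination Real.cos x * h7 - Real.sin x * h8
    - (F.f₀ x - G.f₀ x) * Real.sin_sq_add_cos_sq x

end SuperFun

open SuperFun

/-- The contact Hamiltonians of the subalgebra `𝒦(1)ᵢ` of `𝒦(2)`, where `𝒦(2)` is `SuperFun` with
the contact bracket, `F` standing for the vector field `v_F`: these are `F = f₀ + fᵢ θᵢ`. -/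
def contactSub (i : Fin 2) : Submodule ℝ SuperFun where
  carrier := {F | (i = 0 → F.f₂ = 0) ∧ (i = 1 → F.f₁ = 0) ∧ F.f₁₂ = 0}
  add_mem' := by
    rintro F G ⟨h, h', h''⟩ ⟨k, k', k''⟩
    exact ⟨fun hi => by simp [h hi, k hi], fun hi => by simp [h' hi, k' hi], by simp [h'', k'']⟩
  zero_mem' := by simp
  smul_mem' := by
    rintro r F ⟨h, h', h''⟩
    exact ⟨fun hi => by simp [h hi], fun hi => by simp [h' hi], by simp [h'']⟩

theorem contactBracket_mem {i : Fin 2} {F G : SuperFun} (hF : F ∈ contactSub i)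
    (hG : G ∈ contactSub i) : contactBracket F G ∈ contactSub i := by
  obtain ⟨a, b, c⟩ := hF
  obtain ⟨a', b', c'⟩ := hG
  fin_cases i
  · have h := a rfl
    have h' := a' rfl
    refine ⟨fun _ => ?_, fun h => absurd h (by decide), ?_⟩ <;>
      simp [contactBracket, Fin.sum_univ_two, eta_zero, eta_one, h, h', c, c']
  · have h := b rfl
    have h' := b' rfl
    refine ⟨fun h => absurd h (by decide), fun _ => ?_, ?_⟩ <;>
      simp [contactBracket, Fin.sum_univ_two, eta_zero, eta_one, h, h', c, c']

/-- The bracket of `𝒦(1)ᵢ`. -/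
def contactSubBracket {i : Fin 2} (F G : contactSub i) : contactSub i :=
  ⟨contactBracket F G, contactBracket_mem F.2 G.2⟩

/-- The space `Z¹(𝒦(1)ᵢ, 𝔉_lam)_b` of 1-cocycles of parity `b`: the linear maps `c` from `𝒦(1)ᵢ` to
the densities of weight `lam` that shift the parity by `b` and satisfy
`c([g, h]) = g · c(h) - (-1)^{p(g) p(h)} h · c(g)` for all homogeneous `g`, `h`. -/
def cocycles (i : Fin 2) (lam : ℝ) (b : ZMod 2) : Submodule ℝ (contactSub i →ₗ[ℝ] SuperFun) where
  carrier := {c |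
    (∀ (p : ZMod 2) (F : contactSub i), (F : SuperFun) ∈ parity p → c F ∈ parity (p + b)) ∧
    ∀ (p q : ZMod 2) (F G : contactSub i), (F : SuperFun) ∈ parity p → (G : SuperFun) ∈ parity q →
      c (contactSubBracket F G) =
        lieDensity lam F (c G) - (-1 : ℝ) ^ (p.val * q.val) • lieDensity lam G (c F)}
  add_mem' := by
    rintro c d ⟨h, h'⟩ ⟨k, k'⟩
    refine ⟨fun p F hF => add_mem (h p F hF) (k p F hF), fun p q F G hF hG => ?_⟩
    simp only [LinearMap.add_apply, h' p q F G hF hG, k' p q F G hF hG, lieDensity_add_right,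
      smul_add]
    abel
  zero_mem' := by
    refine ⟨fun p F _ => by simp, fun p q F G _ _ => ?_⟩
    have h : ∀ F : SuperFun, lieDensity lam F 0 = 0 := fun F => by
      simpa using lieDensity_smul_right lam 0 F 0
    simp [h]
  smul_mem' := by
    rintro r c ⟨h, h'⟩
    refine ⟨fun p F hF => Submodule.smul_mem _ r (h p F hF), fun p q F G hF hG => ?_⟩
    simp only [LinearMap.smul_apply, h' p q F G hF hG, lieDensity_smul_right, smul_sub]
    rw [smul_comm]

/-- The 1-coboundaries: the maps `g ↦ g · m` for a density `m` of weight `lam`. -/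
def coboundaries (i : Fin 2) (lam : ℝ) : Submodule ℝ (contactSub i →ₗ[ℝ] SuperFun) where
  carrier := {c | ∃ m : SuperFun, ∀ F : contactSub i, c F = lieDensity lam F m}
  add_mem' := by
    rintro c d ⟨m, hm⟩ ⟨n, hn⟩
    exact ⟨m + n, fun F => by simp [hm, hn, lieDensity_add_right]⟩
  zero_mem' := ⟨0, fun F => by simpa using (lieDensity_smul_right lam 0 F 0).symm⟩
  smul_mem' := by
    rintro r c ⟨m, hm⟩
    exact ⟨r • m, fun F => by simp [hm, lieDensity_smul_right]⟩

/-- `H¹(𝒦(1)ᵢ, 𝔉_lam)_b`: cocycles of parity `b` modulo those that are coboundaries. -/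
abbrev H1 (i : Fin 2) (lam : ℝ) (b : ZMod 2) : Type :=
  cocycles i lam b ⧸ (coboundaries i lam).comap (cocycles i lam b).subtype

/-- The linear maps `c₁, …, c_n` are 1-cocycles of parity `b`, and their cohomology classes form a
basis of `H¹(𝒦(1)ᵢ, 𝔉_lam)_b`. -/
def IsCohomologyBasis (i : Fin 2) (lam : ℝ) (b : ZMod 2) {n : ℕ}
    (c : Fin n → contactSub i →ₗ[ℝ] SuperFun) : Prop :=
  ∃ (h : ∀ k, c k ∈ cocycles i lam b) (B : Module.Basis (Fin n) ℝ (H1 i lam b)),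
    ∀ k, B k = Submodule.Quotient.mk ⟨c k, h k⟩

/-- The odd coordinate `θ_{3-i}`, that is, the one not occurring in `𝒦(1)ᵢ`. -/
def thetaOther (i : Fin 2) : SuperFun := theta (1 - i)

/-- `C₀(v_F) = (3 F + (-1)^{p(F)} F) / 4`. -/
def C0 (i : Fin 2) : contactSub i →ₗ[ℝ] SuperFun where
  toFun F := (1 / 4 : ℝ) • ((3 : ℝ) • (F : SuperFun) + signed F)
  map_add' F G := by simp only [Submodule.coe_add, signed_add, smul_add]; abel
  map_smul' r F := by
    simp only [Submodule.coe_smul, signed_smul, smul_add, RingHom.id_apply]; module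

/-- `C₁(v_F) = F'`. -/
def C1 (i : Fin 2) : contactSub i →ₗ[ℝ] SuperFun where
  toFun F := dx F
  map_add' F G := by simp [dx_add]
  map_smul' r F := by simp [dx_smul]

/-- `C₂(v_F) = η̄ᵢ(F') θ_{3-i}`. -/
def C2 (i : Fin 2) : contactSub i →ₗ[ℝ] SuperFun where
  toFun F := etaBar i (dx F) * thetaOther i
  map_add' F G := by simp [dx_add, etaBar_add, SuperFun.add_mul]
  map_smul' r F := by simp [dx_smul, etaBar_smul, SuperFun.smul_mul]

/-- `C₃(v_F) = η̄ᵢ(F'') θ_{3-i}`. -/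
def C3 (i : Fin 2) : contactSub i →ₗ[ℝ] SuperFun where
  toFun F := etaBar i (dx (dx F)) * thetaOther i
  map_add' F G := by simp [dx_add, etaBar_add, SuperFun.add_mul]
  map_smul' r F := by simp [dx_smul, etaBar_smul, SuperFun.smul_mul]

/-- `C₄(v_F) = (3 F + (-1)^{p(F)} F) θ_{3-i} / 4`. -/
def C4 (i : Fin 2) : contactSub i →ₗ[ℝ] SuperFun where
  toFun F := (1 / 4 : ℝ) • ((3 : ℝ) • (F : SuperFun) + signed F) * thetaOther i
  map_add' F G := by
    rw [← SuperFun.add_mul]; congr 1; exact (C0 i).map_add F G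
  map_smul' r F := by
    rw [RingHom.id_apply, ← SuperFun.smul_mul]; congr 1; exact (C0 i).map_smul r F

/-- `C₅(v_F) = F' θ_{3-i}`. -/
def C5 (i : Fin 2) : contactSub i →ₗ[ℝ] SuperFun where
  toFun F := dx F * thetaOther i
  map_add' F G := by simp [dx_add, SuperFun.add_mul]
  map_smul' r F := by simp [dx_smul, SuperFun.smul_mul]

/-- `C₆(v_F) = η̄ᵢ(F')`. -/
def C6 (i : Fin 2) : contactSub i →ₗ[ℝ] SuperFun where
  toFun F := etaBar i (dx F)
  map_add' F G := by simp [dx_add, etaBar_add]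
  map_smul' r F := by simp [dx_smul, etaBar_smul]

/-- `C₇(v_F) = η̄ᵢ(F'')`. -/
def C7 (i : Fin 2) : contactSub i →ₗ[ℝ] SuperFun where
  toFun F := etaBar i (dx (dx F))
  map_add' F G := by simp [dx_add, etaBar_add]
  map_smul' r F := by simp [dx_smul, etaBar_smul]

end

open scoped ContDiff
open SuperFun

/-! As a module over `𝒦(1)ᵢ`, the densities of weight `lam` on `S^{1|2}` split: writing a density as
`(u + v θᵢ) + (w + z θᵢ) θ_{3-i}`, the pair `(u, v)` transforms with weight `lam` and the pair `(w,
z)` by the same formulas with weight `lam + 1/2` (`lieDensity_pack`). Hence a cocycle of either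
parity is a pair of independent cocycles with values in densities on `S^{1|1}`: an even one `f + a θ
↦ A f + B a θ` and an odd one `f + a θ ↦ B a + A f θ`, of weights `lam` and `lam + 1/2` in an order
fixed by the parity.

Cochains are arbitrary linear maps, with no continuity or locality assumed, so these must come out
of the cocycle equations. In the even case of weight `mu`, the condition on two odd elements, `A (a
b) = a B b + b B a`, makes `A - A 1` a derivation of `C^∞(S¹)`, hence `e ∂ₓ` for some function `e`;
brackets with the constant 1 then give `e' = mu k`, where `k = A 1`. For `mu ≠ 0` this is the
coboundary of `e / mu`. For `mu = 0`, `e` is constant and `k` is a constant plus a derivative, which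
leaves two classes.

In the odd case, after subtracting multiplication by `B 1`, which is the coboundary part, `B`
commutes with `∂ₓ`. Evaluating the remaining identities on `sin` and `cos` forces `B a = p a' + q
a''` with constants satisfying `p (1 - 2 mu) = 0` and `q (3 - 2 mu) = 0`. So odd classes live at `mu
= 1/2` and `mu = 3/2` only.

Substituting the weights `lam` and `lam + 1/2` for `mu` gives the list of exceptional `lam`. The
functions `sin` and `cos` serve throughout as global coordinates on the circle, with `sin² + cos² =
1` replacing partitions of unity. -/

/-! ### Smooth division: Hadamard's lemma and quotients by `1 - cos`. -/

/-- The weight `h` makes the family stable under differentiation: the derivative is an integral of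
the same form with weight `h t * t` and function `deriv f`. This drives the induction proving
smoothness. -/
theorem hasDerivAt_integral_mul_comp_mul {h f : ℝ → ℝ} (hh : Continuous h) (hf : ContDiff ℝ ∞ f)
    (x : ℝ) : HasDerivAt (fun x => ∫ t in (0 : ℝ)..1, h t * f (x * t))
      (∫ t in (0 : ℝ)..1, (h t * t) * deriv f (x * t)) x := by
  have hc : Continuous f := hf.continuous
  have hc' : Continuous (deriv f) := (contDiff_infty_iff_deriv.1 hf).2.continuous
  have hd : Differentiable ℝ f := (contDiff_infty_iff_deriv.1 hf).1
  have hk : IsCompact (Metric.closedBall x 1 ×ˢ Set.Icc (0 : ℝ) 1) :=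
    (isCompact_closedBall x 1).prod isCompact_Icc
  obtain ⟨C, hC⟩ := hk.exists_bound_of_continuousOn
    (f := fun p : ℝ × ℝ => (h p.2 * p.2) * deriv f (p.1 * p.2))
    (by fun_prop)
  refine (intervalIntegral.hasDerivAt_integral_of_dominated_loc_of_deriv_le
    (F := fun x t => h t * f (x * t)) (F' := fun x t => (h t * t) * deriv f (x * t))
    (bound := fun _ => C) (s := Metric.closedBall x 1)
    (Metric.closedBall_mem_nhds x one_pos) ?_ ?_ ?_ ?_ ?_ ?_).2
  · exact .of_forall fun y => (by fun_prop : Continuous _).aestronglyMeasurable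
  · exact (by fun_prop : Continuous _).intervalIntegrable _ _
  · exact (by fun_prop : Continuous _).aestronglyMeasurable
  · refine .of_forall fun t ht y hy => hC (y, t) ⟨hy, ?_⟩
    rw [Set.uIoc_of_le zero_le_one] at ht
    exact ⟨ht.1.le, ht.2⟩
  · exact intervalIntegrable_const
  · refine .of_forall fun t _ y _ => ?_
    have h1 : HasDerivAt (fun y => f (y * t)) (deriv f (y * t) * t) y :=
      (hd (y * t)).hasDerivAt.comp y (by simpa using (hasDerivAt_id y).mul_const t)
    exact (h1.const_mul (h t)).congr_deriv (by ring)

theorem contDiff_integral_mul_comp_mul {h f : ℝ → ℝ} (hh : Continuous h) (hf : ContDiff ℝ ∞ f) :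
    ContDiff ℝ ∞ (fun x => ∫ t in (0 : ℝ)..1, h t * f (x * t)) := by
  refine contDiff_infty.2 fun n => ?_
  induction n generalizing h f with
  | zero =>
    exact contDiff_zero.2 (continuous_iff_continuousAt.2 fun x =>
      (hasDerivAt_integral_mul_comp_mul hh hf x).continuousAt)
  | succ n ih =>
    have hd := fun x => hasDerivAt_integral_mul_comp_mul hh hf x
    rw [Nat.cast_succ, contDiff_succ_iff_deriv]
    refine ⟨fun x => (hd x).differentiableAt, fun h => absurd h (by simp), ?_⟩
    rw [funext fun x => (hd x).deriv]
    exact ih (by fun_prop) (contDiff_infty_iff_deriv.1 hf).2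

/-- **Hadamard's lemma** in one variable. -/
theorem exists_contDiff_mul_of_eq_zero {f : ℝ → ℝ} (hf : ContDiff ℝ ∞ f) (h0 : f 0 = 0) :
    ∃ g : ℝ → ℝ, ContDiff ℝ ∞ g ∧ (∀ x, f x = x * g x) ∧ g 0 = deriv f 0 := by
  -- The quotient comes from integrating `d/dt f (x t) = x f' (x t)` over `[0, 1]`; the factor `1`
  -- is the weight `h`.
  refine ⟨fun x => ∫ t in (0 : ℝ)..1, 1 * deriv f (x * t),
    contDiff_integral_mul_comp_mul continuous_const (contDiff_infty_iff_deriv.1 hf).2,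
    fun x => ?_, by simp⟩
  have hc' : Continuous (deriv f) := (contDiff_infty_iff_deriv.1 hf).2.continuous
  have h : ∫ t in (0 : ℝ)..1, x * deriv f (x * t) = f (x * 1) - f (x * 0) := by
    refine intervalIntegral.integral_eq_sub_of_hasDerivAt (f := fun t => f (x * t)) (fun t _ => ?_)
      ((by fun_prop : Continuous fun t => x * deriv f (x * t)).intervalIntegrable _ _)
    exact (((contDiff_infty_iff_deriv.1 hf).1 (x * t)).hasDerivAt.comp t
      (by simpa using (hasDerivAt_id t).const_mul x)).congr_deriv (by ring)
  rw [intervalIntegral.integral_const_mul] at h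
  simp only [one_mul]
  rw [h]; simp [h0]

theorem exists_contDiff_sq_mul_of_eq_zero {f : ℝ → ℝ} (hf : ContDiff ℝ ∞ f) (h0 : f 0 = 0)
    (h1 : deriv f 0 = 0) :
    ∃ g : ℝ → ℝ, ContDiff ℝ ∞ g ∧ (∀ x, f x = x ^ 2 * g x) := by
  obtain ⟨g, hg, hfg, hg0⟩ := exists_contDiff_mul_of_eq_zero hf h0
  obtain ⟨k, hk, hgk, -⟩ := exists_contDiff_mul_of_eq_zero hg (hg0.trans h1)
  exact ⟨k, hk, fun x => by rw [hfg, hgk]; ring⟩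

/-- On the circle `1 - cos x = 2 sin² (x/2)` vanishes only at 0, to order exactly two, so it divides
every function with a double zero there. Near 0 both functions are `x²` times a smooth factor, and
the factor of the denominator does not vanish; periodicity carries smoothness to the other zeros. -/
theorem contDiff_div_one_sub_cos {f : ℝ → ℝ} (hf : ContDiff ℝ ∞ f)
    (hp : Function.Periodic f (2 * Real.pi)) (h0 : f 0 = 0) (h1 : deriv f 0 = 0) :
    ∃ u : ℝ → ℝ, ContDiff ℝ ∞ u ∧ Function.Periodic u (2 * Real.pi) ∧
      ∀ x, f x = (1 - Real.cos x) * u x := by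
  obtain ⟨g, hg, hfg⟩ := exists_contDiff_sq_mul_of_eq_zero hf h0 h1
  obtain ⟨w, hw, hsw, hw0⟩ :=
    exists_contDiff_mul_of_eq_zero Real.contDiff_sin Real.sin_zero
  have hw1 : w 0 = 1 := by simp [hw0]
  have hcos : ∀ x, 1 - Real.cos x = x ^ 2 * (w (x / 2) ^ 2 / 2) := fun x => by
    have e := Real.cos_sq (x / 2)
    rw [mul_div_cancel₀ x two_ne_zero] at e
    have e1 := Real.sin_sq_add_cos_sq (x / 2)
    rw [hsw (x / 2)] at e1
    linear_combination 2 * e - 2 * e1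
  have hzero : ∀ x, Real.cos x = 1 → f x = 0 := fun x hx => by
    obtain ⟨n, hn⟩ := (Real.cos_eq_one_iff x).1 hx
    have := hp.int_mul n 0
    rw [zero_add, hn, h0] at this
    exact this
  -- the quotient, with its limit filled in at the zeros of the denominator
  let u : ℝ → ℝ := fun x => if Real.cos x = 1 then 2 * g 0 else f x / (1 - Real.cos x)
  have hup : Function.Periodic u (2 * Real.pi) := fun x => by
    simp only [u, Real.cos_add_two_pi, hp x]
  have hu : ∀ x, f x = (1 - Real.cos x) * u x := fun x => by
    by_cases hx : Real.cos x = 1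
    · simp [hzero x hx, hx]
    · have : 1 - Real.cos x ≠ 0 := sub_ne_zero.2 (Ne.symm hx)
      simp only [u, hx, if_false]; field_simp
  have hu0 : ContDiffAt ℝ ∞ u 0 := by
    have hne : ∀ᶠ x in nhds (0 : ℝ), w (x / 2) ≠ 0 := by
      have hc : Continuous fun x : ℝ => w (x / 2) := by
        have := hw.continuous; fun_prop
      exact hc.continuousAt.eventually_ne (by simp [hw1])
    have hs : ContDiffAt ℝ ∞ (fun x => g x / (w (x / 2) ^ 2 / 2)) 0 := by
      refine hg.contDiffAt.div ?_ (by simp [hw1])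
      exact ((hw.comp (contDiff_id.div_const 2)).pow 2).div_const 2 |>.contDiffAt
    refine hs.congr_of_eventuallyEq ?_
    filter_upwards [hne, eventually_abs_sub_lt (0 : ℝ) Real.two_pi_pos] with x hx hlt
    rw [sub_zero, abs_lt] at hlt
    by_cases hx0 : x = 0
    · subst hx0; simp [u, hw1]; ring
    · have hcx : Real.cos x ≠ 1 := fun h =>
        hx0 ((Real.cos_eq_one_iff_of_lt_of_lt hlt.1 hlt.2).1 h)
      simp only [u, hcx, if_false, hcos x, hfg x]
      field_simp
  refine ⟨u, contDiff_iff_contDiffAt.2 fun x => ?_, hup, hu⟩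
  by_cases hx : Real.cos x = 1
  · obtain ⟨n, hn⟩ := (Real.cos_eq_one_iff x).1 hx
    have hsh : u = fun y => u (y - x) := funext fun y => by
      rw [← hn]; exact (hup.sub_int_mul_eq n).symm
    rw [hsh]
    exact ContDiffAt.comp (g := u) (f := fun y => y - x) x (by simpa using hu0) (by fun_prop)
  · have hne : ∀ᶠ y in nhds x, Real.cos y ≠ 1 :=
      Real.continuous_cos.continuousAt.eventually_ne hx
    have hs : ContDiffAt ℝ ∞ (fun y => f y / (1 - Real.cos y)) x :=
      hf.contDiffAt.div (contDiff_const.sub Real.contDiff_cos).contDiffAt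
        (sub_ne_zero.2 (Ne.symm hx))
    refine hs.congr_of_eventuallyEq ?_
    filter_upwards [hne] with y hy
    simp [u, hy]

/-! ### Derivations, primitives and constants in `C^∞(S¹)`. -/

namespace CircleFun

theorem ext {f g : CircleFun} (h : ∀ x, f x = g x) : f = g := Subtype.ext (funext h)

theorem add_apply (f g : CircleFun) (x : ℝ) : (f + g) x = f x + g x := rfl
theorem sub_apply (f g : CircleFun) (x : ℝ) : (f - g) x = f x - g x := rfl
theorem neg_apply (f : CircleFun) (x : ℝ) : (-f) x = -f x := rfl
theorem mul_apply (f g : CircleFun) (x : ℝ) : (f * g) x = f x * g x := rfl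
theorem smul_apply (r : ℝ) (f : CircleFun) (x : ℝ) : (r • f) x = r * f x := rfl
theorem algebraMap_apply (r x : ℝ) : (algebraMap ℝ CircleFun r) x = r := rfl
theorem one_apply (x : ℝ) : (1 : CircleFun) x = 1 := rfl
theorem zero_apply (x : ℝ) : (0 : CircleFun) x = 0 := rfl

/-- The function `sin` on the circle. -/
noncomputable def sin : CircleFun := (⟨Real.sin, Real.contDiff_sin, Real.sin_periodic⟩ : smoothCircle)

/-- The function `cos` on the circle. -/
noncomputable def cos : CircleFun := (⟨Real.cos, Real.contDiff_cos, Real.cos_periodic⟩ : smoothCircle)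

theorem sin_apply (x : ℝ) : sin x = Real.sin x := rfl
theorem cos_apply (x : ℝ) : cos x = Real.cos x := rfl

theorem circleDeriv_sin : circleDeriv sin = cos := ext fun x => by
  change deriv Real.sin x = Real.cos x
  simp

theorem circleDeriv_cos : circleDeriv cos = -sin := ext fun x => by
  change deriv Real.cos x = -Real.sin x
  simp

theorem sin_mul_sin_add_cos_mul_cos : sin * sin + cos * cos = 1 := ext fun x => by
  change Real.sin x * Real.sin x + Real.cos x * Real.cos x = 1
  linear_combination Real.sin_sq_add_cos_sq x

/-- The divisor is `1 - cos (x - t)`, expanded so that it is visibly a combination of `1`, `cos` and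
`sin`, which a derivation killing `sin` and `cos` also kills. -/
theorem exists_eq_one_sub_cos_mul (f : CircleFun) (t : ℝ) (h0 : f t = 0)
    (h1 : circleDeriv f t = 0) :
    ∃ u : CircleFun, f = (1 - (Real.cos t • cos + Real.sin t • sin)) * u := by
  obtain ⟨u, hu, hup, hfu⟩ := contDiff_div_one_sub_cos (f := fun x => f (x + t))
    (f.property.1.comp (contDiff_id.add contDiff_const))
    (fun x => by
      have := f.property.2 (x + t)
      change f (x + 2 * Real.pi + t) = f (x + t)
      rw [add_right_comm]; exact this) (by simpa using h0)
    (by rw [deriv_comp_add_const, zero_add]; exact h1)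
  refine ⟨(⟨fun x => u (x - t), hu.comp (contDiff_id.sub contDiff_const), fun x => ?_⟩ :
    smoothCircle), ext fun x => ?_⟩
  · change u (x + 2 * Real.pi - t) = u (x - t)
    rw [← hup (x - t)]; congr 1; ring
  · have h := hfu (x - t)
    rw [sub_add_cancel, Real.cos_sub] at h
    change f x = (1 - (Real.cos t * Real.cos x + Real.sin t * Real.sin x)) * u (x - t)
    rw [h]; ring

/-- At each `t`, subtract from `f` the trigonometric first-order Taylor polynomial `f t + f' t sin
(x - t)`, which `D` kills. The remainder is `(1 - cos (x - t)) u`, and `D` maps it to `(1 - cos (x -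
t)) D u`, which vanishes at `t`. -/
theorem derivation_eq_zero (D : Derivation ℝ CircleFun CircleFun) (hs : D sin = 0)
    (hc : D cos = 0) : D = 0 := by
  refine Derivation.ext fun f => ext fun t => ?_
  obtain ⟨u, hu⟩ := exists_eq_one_sub_cos_mul
    (f - (algebraMap ℝ CircleFun (f t) +
      circleDeriv f t • (Real.cos t • sin - Real.sin t • cos))) t
    (by
      simp only [sub_apply, add_apply, algebraMap_apply, smul_apply, sin_apply, cos_apply]
      ring)
    (by
      simp only [map_sub, map_add, circleDeriv.map_algebraMap, Derivation.map_smul,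
        circleDeriv_sin, circleDeriv_cos, sub_apply, add_apply, smul_apply, sin_apply, cos_apply,
        neg_apply, zero_apply]
      linear_combination -(circleDeriv f t) * Real.sin_sq_add_cos_sq t)
  have h := congrArg D hu
  simp only [map_sub, map_add, D.map_algebraMap, Derivation.map_smul, hs, hc, Derivation.leibniz,
    smul_eq_mul, smul_zero, sub_zero, add_zero, Derivation.map_one_eq_zero, mul_zero] at h
  rw [h]
  simp only [mul_apply, sub_apply, add_apply, smul_apply, sin_apply, cos_apply, one_apply,
    Derivation.zero_apply, zero_apply]
  linear_combination -(D u t) * Real.sin_sq_add_cos_sq t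

/-- Every derivation of `C^∞(S¹)` is a vector field. -/
theorem derivation_eq_smul_circleDeriv (D : Derivation ℝ CircleFun CircleFun) :
    ∃ e : CircleFun, ∀ f, D f = e * circleDeriv f := by
  have hp := sin_mul_sin_add_cos_mul_cos
  have hp' := congrArg D hp
  simp only [map_add, Derivation.leibniz, smul_eq_mul, Derivation.map_one_eq_zero] at hp'
  have two := SuperFun.halfFun_two
  have hq : sin * D sin + cos * D cos = 0 := by
    linear_combination SuperFun.halfFun * hp' - (sin * D sin + cos * D cos) * two
  -- A vector field `e ∂ₓ` sends `sin` to `e cos` and `cos` to `-e sin`; this is the only possible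
  -- `e`, and `hq` ensures that it reproduces both values.
  let e := cos * D sin - sin * D cos
  have h := derivation_eq_zero (D - e • circleDeriv)
    (by
      simp only [Derivation.sub_apply, Derivation.smul_apply, circleDeriv_sin, smul_eq_mul, e]
      linear_combination -(D sin) * hp + sin * hq)
    (by
      simp only [Derivation.sub_apply, Derivation.smul_apply, circleDeriv_cos, smul_eq_mul, e]
      linear_combination -(D cos) * hp + cos * hq)
  refine ⟨e, fun f => ?_⟩
  have h2 := congrArg (fun D' : Derivation ℝ CircleFun CircleFun => D' f) h
  simpa [sub_eq_zero] using h2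

/-- The constant is the mean of `k`. Subtracting it makes the integral over a period vanish, which
is what makes the primitive periodic. -/
theorem exists_eq_algebraMap_add_circleDeriv (k : CircleFun) :
    ∃ (r : ℝ) (u : CircleFun), k = algebraMap ℝ CircleFun r + circleDeriv u := by
  have hk : ContDiff ℝ ∞ (k : ℝ → ℝ) := k.property.1
  have hkp : Function.Periodic (k : ℝ → ℝ) (2 * Real.pi) := k.property.2
  have hkc := hk.continuous
  let r : ℝ := (∫ x in (0 : ℝ)..2 * Real.pi, k x) / (2 * Real.pi)
  let g : ℝ → ℝ := fun x => k x - r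
  have hg : ContDiff ℝ ∞ g := hk.sub contDiff_const
  have hgc := hg.continuous
  have hgp : Function.Periodic g (2 * Real.pi) := fun x => by simp only [g, hkp x]
  have hg0 : ∫ x in (0 : ℝ)..2 * Real.pi, g x = 0 := by
    rw [intervalIntegral.integral_sub (hkc.intervalIntegrable _ _) intervalIntegrable_const]
    have := Real.two_pi_pos.ne'
    simp only [intervalIntegral.integral_const, smul_eq_mul, r]
    field_simp; ring
  have hd : ∀ x, HasDerivAt (fun x => ∫ t in (0 : ℝ)..x, g t) (g x) x := fun x =>
    intervalIntegral.integral_hasDerivAt_right (hgc.intervalIntegrable _ _)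
      hgc.stronglyMeasurable.stronglyMeasurableAtFilter hgc.continuousAt
  have hdd : deriv (fun x => ∫ t in (0 : ℝ)..x, g t) = g := funext fun x => (hd x).deriv
  refine ⟨r, (⟨fun x => ∫ t in (0 : ℝ)..x, g t,
    contDiff_infty_iff_deriv.2 ⟨fun x => (hd x).differentiableAt, by rwa [hdd]⟩, fun x => ?_⟩ :
      smoothCircle), ext fun x => ?_⟩
  · dsimp only
    rw [← intervalIntegral.integral_add_adjacent_intervals (hgc.intervalIntegrable 0 x)
      (hgc.intervalIntegrable _ _), hgp.intervalIntegral_add_eq x 0, zero_add, hg0, add_zero]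
  · change k x = r + deriv (fun x => ∫ t in (0 : ℝ)..x, g t) x
    rw [hdd]; simp [g]

theorem exists_eq_algebraMap_of_circleDeriv_eq_zero {f : CircleFun} (h : circleDeriv f = 0) :
    ∃ r : ℝ, f = algebraMap ℝ CircleFun r :=
  ⟨f 0, ext fun x => is_const_of_deriv_eq_zero f.differentiable
    (fun y => congrArg (fun g : CircleFun => g y) h) x 0⟩

/-- By Rolle, the derivative of a periodic function vanishes somewhere. -/
theorem eq_zero_of_algebraMap_eq_circleDeriv {r : ℝ} {u : CircleFun}
    (h : algebraMap ℝ CircleFun r = circleDeriv u) : r = 0 := by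
  have hc : ContDiff ℝ ∞ (u : ℝ → ℝ) := u.property.1
  obtain ⟨x, -, hx⟩ := exists_deriv_eq_zero Real.two_pi_pos hc.continuous.continuousOn
    (by simpa using (u.property.2 0).symm)
  exact (congrArg (fun g : CircleFun => g x) h).trans hx

end CircleFun

open CircleFun

/-! ### Solution of the functional equations for the coefficients of a cocycle. -/

namespace CircleFun

theorem eq_zero_of_mul_circleDeriv {e : CircleFun} (h : ∀ g, e * circleDeriv g = 0) : e = 0 := by
  have hs := h sin
  have hc := h cos
  rw [circleDeriv_sin] at hs
  rw [circleDeriv_cos] at hc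
  linear_combination -e * sin_mul_sin_add_cos_mul_cos + cos * hs - sin * hc

/-- Putting `b = 1` expresses `B` through `A`, and `a = b = 1` gives `A 1 = 2 B 1`. Substituted
back, the identity is the Leibniz rule for `A - A 1`. -/
theorem exists_derivation_of_mul {A B : CircleFun →ₗ[ℝ] CircleFun}
    (h : ∀ a b, A (a * b) = a * B b + b * B a) :
    ∃ e : CircleFun, (∀ f, A f = e * circleDeriv f + A 1 * f) ∧
      ∀ a, B a = e * circleDeriv a + (1 / 2 : ℝ) • (A 1 * a) := by
  have h1 : A 1 = B 1 + B 1 := by simpa using h 1 1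
  have hB : ∀ a, B a = A a - a * B 1 := fun a => by
    have := h a 1
    rw [mul_one, one_mul] at this
    rw [this]; ring
  let D : Derivation ℝ CircleFun CircleFun :=
    Derivation.mk' (A - LinearMap.mulLeft ℝ (A 1)) fun a b => by
      simp only [LinearMap.sub_apply, LinearMap.mulLeft_apply, smul_eq_mul]
      rw [h a b, hB a, hB b, h1]
      ring
  obtain ⟨e, he⟩ := derivation_eq_smul_circleDeriv D
  have hA : ∀ f, A f = e * circleDeriv f + A 1 * f := fun f => by
    rw [← he f]
    change A f = (A f - A 1 * f) + A 1 * f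
    ring
  refine ⟨e, hA, fun a => ?_⟩
  rw [hB, hA a, h1, Algebra.smul_def, show algebraMap ℝ CircleFun (1 / 2) = halfFun from rfl]
  linear_combination -(B 1 * a) * halfFun_two

/-- The cocycles on `𝒦(1)` with values in the densities of weight `mu` of the form
`f + a θ ↦ A f + B a θ`. -/
theorem exists_of_even_cocycle {mu : ℝ} {A B : CircleFun →ₗ[ℝ] CircleFun}
    (h₁ : ∀ f g, A (f * circleDeriv g - circleDeriv f * g) =
      f * circleDeriv (A g) + mu • (circleDeriv f * A g)
        - (g * circleDeriv (A f) + mu • (circleDeriv g * A f)))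
    (h₂ : ∀ a b, A (a * b) = a * B b + b * B a) :
    ∃ e k : CircleFun, (∀ f, A f = e * circleDeriv f + k * f) ∧
      (∀ a, B a = e * circleDeriv a + (1 / 2 : ℝ) • (k * a)) ∧ circleDeriv e = mu • k := by
  obtain ⟨e, hA, hB⟩ := exists_derivation_of_mul h₂
  generalize A 1 = k at hA hB
  refine ⟨e, k, hA, hB, sub_eq_zero.1 (eq_zero_of_mul_circleDeriv fun g => ?_)⟩
  -- The bracket with the constant 1 reduces to `(e' - mu k) g' = 0` for every `g`.
  have h := h₁ 1 g
  simp only [hA, circleDeriv_mul, map_add, Derivation.map_one_eq_zero, one_mul, zero_mul, mul_zero,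
    mul_one, sub_zero, Algebra.smul_def, zero_add] at h ⊢
  linear_combination -h

/-- A linear map with `3 b(f a') = 3 f b(a') + 4 mu f' b(a) + 2 mu a' b(f)` that kills constants
and commutes with the derivative is a differential operator of order at most 2. -/
theorem exists_of_commute_circleDeriv {mu : ℝ} {b : CircleFun → CircleFun} (b₀ : b 1 = 0)
    (bneg : ∀ f, b (-f) = -b f) (badd : ∀ f g, b (f + g) = b f + b g)
    (bd : ∀ f, b (circleDeriv f) = circleDeriv (b f))
    (h : ∀ f a, 3 * b (f * circleDeriv a) = 3 * (f * b (circleDeriv a)) +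
      algebraMap ℝ CircleFun mu * (4 * (circleDeriv f * b a) + 2 * (circleDeriv a * b f))) :
    ∃ p q : ℝ, (∀ a, b a = p • circleDeriv a + q • circleDeriv (circleDeriv a)) ∧
      p * (1 - 2 * mu) = 0 ∧ q * (3 - 2 * mu) = 0 := by
  have hp := sin_mul_sin_add_cos_mul_cos
  have inv3 : algebraMap ℝ CircleFun (1 / 3) * 3 = 1 := by
    rw [← map_ofNat (algebraMap ℝ CircleFun) 3, ← map_mul]; norm_num
  by_cases hmu : mu = 0
  -- For `mu = 0` the identity says that `b` is `C^∞(S¹)`-linear on multiples of derivatives. As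
  -- `sin` and `cos` are derivatives and `f = f sin² + f cos²`, `b` is linear over all functions,
  -- and `b 1 = 0` kills it.
  · refine ⟨0, 0, fun a => ?_, by simp, by simp⟩
    have h0 : ∀ f a, b (f * circleDeriv a) = f * b (circleDeriv a) := fun f a => by
      have := h f a
      rw [hmu, map_zero, zero_mul, add_zero] at this
      linear_combination algebraMap ℝ CircleFun (1 / 3) * this +
        (f * b (circleDeriv a) - b (f * circleDeriv a)) * inv3
    have hs : ∀ f, b (f * sin) = f * b sin := fun f => by
      have := h0 f (-cos)
      rwa [map_neg, circleDeriv_cos, neg_neg] at this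
    have hc : ∀ f, b (f * cos) = f * b cos := fun f => by
      have := h0 f sin
      rwa [circleDeriv_sin] at this
    have hm : ∀ f, b f = f * (sin * b sin + cos * b cos) := fun f => by
      have := badd (f * sin * sin) (f * cos * cos)
      rw [hs, hc, show f * sin * sin + f * cos * cos = f by linear_combination f * hp] at this
      rw [this]; ring
    have h1 := hm 1
    rw [b₀, one_mul] at h1
    rw [hm a, ← h1]; simp
  · set m := algebraMap ℝ CircleFun mu with hm
    obtain ⟨n, hn⟩ : ∃ n : CircleFun, 4 * m * n = 1 := ⟨algebraMap ℝ CircleFun (1 / (4 * mu)), by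
      rw [← map_ofNat (algebraMap ℝ CircleFun) 4, hm, ← map_mul, ← map_mul,
        ← map_one (algebraMap ℝ CircleFun)]
      congr 1; field_simp⟩
    have hbs : b (circleDeriv sin) = b cos := by rw [circleDeriv_sin]
    have hbc : b (circleDeriv cos) = -b sin := by rw [circleDeriv_cos, bneg]
    -- With `f = g'` the left side `3 b (g' a')` of the hypothesis is symmetric in `g` and `a`, so
    -- the right side is too.
    have hsym : ∀ g a, (3 - 2 * m) * (circleDeriv g * b (circleDeriv a)) +
        4 * m * (circleDeriv (circleDeriv g) * b a) =
        (3 - 2 * m) * (circleDeriv a * b (circleDeriv g)) +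
        4 * m * (circleDeriv (circleDeriv a) * b g) := fun g a => by
      have h1 := h (circleDeriv g) a
      have h2 := h (circleDeriv a) g
      rw [mul_comm (circleDeriv a) (circleDeriv g)] at h2
      linear_combination h2 - h1
    -- Take `a = sin` and `a = cos` in `hsym`, multiply by `sin` and `cos` and add: the terms in `b
    -- (g')` cancel, and `4 m b g` remains, to be divided by `4 m`.
    have hdiff : ∀ g, b g = (n * (3 - 2 * m) * (cos * b sin - sin * b cos)) * circleDeriv g
        + (-(sin * b sin + cos * b cos)) * circleDeriv (circleDeriv g) := fun g => by
      have h1 := hsym g sin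
      have h2 := hsym g cos
      rw [hbs, circleDeriv_sin, circleDeriv_cos] at h1
      rw [hbc, circleDeriv_cos, map_neg, circleDeriv_sin] at h2
      linear_combination n * (sin * h1 + cos * h2) - 4 * m * n * b g * hp -
        (b g + (sin * b sin + cos * b cos) * circleDeriv (circleDeriv g)) * hn
    generalize n * (3 - 2 * m) * (cos * b sin - sin * b cos) = P at hdiff
    generalize -(sin * b sin + cos * b cos) = Q at hdiff
    have hPQ : ∀ g, circleDeriv P * circleDeriv g +
        circleDeriv Q * circleDeriv (circleDeriv g) = 0 := fun g => by
      have := bd g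
      rw [hdiff g, hdiff (circleDeriv g)] at this
      simp only [map_add, circleDeriv_mul] at this
      linear_combination -this
    -- Commutation with `∂ₓ` gives `P' g' + Q' g'' = 0`. For `g = sin, cos` this is an invertible
    -- system, so `P` and `Q` are constant.
    have hPs := hPQ sin
    have hPc := hPQ cos
    simp only [circleDeriv_sin, circleDeriv_cos, map_neg] at hPs hPc
    obtain ⟨p, rfl⟩ := exists_eq_algebraMap_of_circleDeriv_eq_zero (f := P) (by
      linear_combination cos * hPs - sin * hPc - circleDeriv P * hp)
    obtain ⟨q, rfl⟩ := exists_eq_algebraMap_of_circleDeriv_eq_zero (f := Q) (by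
      linear_combination -sin * hPs - cos * hPc - circleDeriv Q * hp)
    have key : ∀ f a, algebraMap ℝ CircleFun p * (3 - 6 * m) * (circleDeriv f * circleDeriv a) +
        algebraMap ℝ CircleFun q * (3 - 2 * m) *
          (2 * (circleDeriv f * circleDeriv (circleDeriv a)) +
            circleDeriv (circleDeriv f) * circleDeriv a) = 0 := fun f a => by
      have := h f a
      simp only [hdiff, map_add, circleDeriv_mul] at this
      linear_combination this
    have kss := key sin sin
    have kcc := key cos cos
    have ksc := key sin cos
    have kcs := key cos sin
    simp only [circleDeriv_sin, circleDeriv_cos, map_neg] at kss kcc ksc kcs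
    have inj : ∀ r : ℝ, algebraMap ℝ CircleFun r = 0 → r = 0 := fun r hr =>
      congrArg (fun g : CircleFun => g 0) hr
    refine ⟨p, q, fun a => by rw [hdiff, Algebra.smul_def, Algebra.smul_def], ?_, ?_⟩
    -- The sum over `f = a = sin` and `f = a = cos` isolates the coefficient of `p`; below,
    -- antisymmetrizing in `sin` and `cos` isolates that of `q`.
    · have : 3 * (p * (1 - 2 * mu)) = 0 := inj _ (by
        simp only [map_mul, map_sub, map_one, map_ofNat, ← hm]
        linear_combination kss + kcc - algebraMap ℝ CircleFun p * (3 - 6 * m) * hp)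
      linarith
    · exact inj _ (by
        simp only [map_mul, map_sub, map_ofNat, ← hm]
        linear_combination kcs - ksc - algebraMap ℝ CircleFun q * (3 - 2 * m) * hp)

/-- The cocycles on `𝒦(1)` with values in the densities of weight `mu` of the form
`f + a θ ↦ B a + A f θ`. -/
theorem exists_of_odd_cocycle {mu : ℝ} {A B : CircleFun →ₗ[ℝ] CircleFun}
    (h₁ : ∀ f a, B (f * circleDeriv a - (1 / 2 : ℝ) • (circleDeriv f * a)) =
      f * circleDeriv (B a) + mu • (circleDeriv f * B a) - (1 / 2 : ℝ) • (a * A f))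
    (h₂ : ∀ a b, A (a * b) = a * circleDeriv (B b) + b * circleDeriv (B a) +
      (2 * mu) • (circleDeriv a * B b + circleDeriv b * B a)) :
    ∃ (w : CircleFun) (p q : ℝ),
      (∀ a, B a = w * a + p • circleDeriv a + q • circleDeriv (circleDeriv a)) ∧
      (∀ f, A f = 2 * (f * circleDeriv w) + (2 * mu + 1) • (circleDeriv f * w) +
        p • circleDeriv (circleDeriv f) + q • circleDeriv (circleDeriv (circleDeriv f))) ∧
      p * (1 - 2 * mu) = 0 ∧ q * (3 - 2 * mu) = 0 := by
  set w := B 1 with hw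
  set m := algebraMap ℝ CircleFun mu with hm
  have ht := halfFun_two
  have htd : algebraMap ℝ CircleFun (1 / 2) = halfFun := rfl
  have h₁' : ∀ f a, 2 * B (f * circleDeriv a) - B (circleDeriv f * a) =
      2 * (f * circleDeriv (B a)) + 2 * (m * (circleDeriv f * B a)) - a * A f := fun f a => by
    have := h₁ f a
    simp only [map_sub, map_smul] at this
    simp only [Algebra.smul_def, htd, ← hm] at this
    linear_combination 2 * this + (B (circleDeriv f * a) - a * A f) * ht
  have h₂' : ∀ a b, A (a * b) = a * circleDeriv (B b) + b * circleDeriv (B a) +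
      2 * m * (circleDeriv a * B b + circleDeriv b * B a) := fun a b => by
    have := h₂ a b
    simpa only [Algebra.smul_def, map_mul, map_ofNat, ← hm] using this
  -- Putting the constant 1 in the even-odd equation determines `A` from `B`; putting it in the
  -- odd-odd equation then yields `hBd`, that is, `B - w` commutes with `∂ₓ`.
  have hA : ∀ f, A f = 2 * (f * circleDeriv w) + 2 * m * (circleDeriv f * w) +
      B (circleDeriv f) := fun f => by
    have := h₁' f 1
    simp only [Derivation.map_one_eq_zero, mul_zero, map_zero, mul_one, ← hw] at this
    linear_combination this
  have hBd : ∀ f, circleDeriv (B f) = f * circleDeriv w + B (circleDeriv f) := fun f => by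
    have := h₂' f 1
    simp only [Derivation.map_one_eq_zero, mul_one, ← hw] at this
    linear_combination hA f - this
  obtain ⟨p, q, hb, hp, hq⟩ := exists_of_commute_circleDeriv (mu := mu) (b := fun f => B f - w * f)
    (by rw [mul_one, ← hw, sub_self]) (fun f => by rw [map_neg]; ring)
    (fun f g => by rw [map_add]; ring)
    (fun f => by rw [map_sub, circleDeriv_mul, hBd]; ring)
    (fun f a => by
      have e1 := h₁' f a
      have e2 := h₁' a f
      rw [mul_comm a, mul_comm (circleDeriv a)] at e2
      rw [hBd, hA] at e1 e2
      rw [← hm]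
      -- This combination of the equation and its swap eliminates `B (f' a)` and leaves `3 B (f
      -- a')`.
      linear_combination 2 * e1 + e2)
  have hB : ∀ a, B a = w * a + p • circleDeriv a + q • circleDeriv (circleDeriv a) := fun a => by
    linear_combination hb a
  refine ⟨w, p, q, hB, fun f => ?_, hp, hq⟩
  rw [hA, hB, add_smul, one_smul, Algebra.smul_def (2 * mu), map_mul, map_ofNat, ← hm]
  ring

end CircleFun

/-! ### Splitting of the densities over `𝒦(1)ᵢ`. -/

namespace SuperFun

/-- The components of a superfunction `u + v θᵢ + (w + z θᵢ) θ_{3-i}`, up to sign, adapted to the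
splitting of the densities into two modules over `𝒦(1)ᵢ`. -/
def components (i : Fin 2) : SuperFun ≃ₗ[ℝ] CircleFun × CircleFun × CircleFun × CircleFun where
  toFun F := if i = 0 then (F.f₀, F.f₁, F.f₂, F.f₁₂) else (F.f₀, F.f₂, F.f₁, -F.f₁₂)
  invFun p := if i = 0 then ⟨p.1, p.2.1, p.2.2.1, p.2.2.2⟩ else ⟨p.1, p.2.2.1, p.2.1, -p.2.2.2⟩
  map_add' F G := by split_ifs <;> simp [add_comm]
  map_smul' r F := by split_ifs <;> simp
  left_inv F := by fin_cases i <;> simp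
  right_inv p := by fin_cases i <;> simp

/-- The superfunction with given components. -/
def pack (i : Fin 2) (u v w z : CircleFun) : SuperFun := (components i).symm (u, v, w, z)

theorem pack_zero (u v w z : CircleFun) : pack 0 u v w z = ⟨u, v, w, z⟩ := rfl
theorem pack_one (u v w z : CircleFun) : pack 1 u v w z = ⟨u, w, v, -z⟩ := rfl

theorem exists_eq_pack (i : Fin 2) (F : SuperFun) : ∃ u v w z, F = pack i u v w z :=
  ⟨_, _, _, _, ((components i).symm_apply_apply F).symm⟩

theorem pack_inj {i : Fin 2} {u v w z u' v' w' z' : CircleFun} :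
    pack i u v w z = pack i u' v' w' z' ↔ u = u' ∧ v = v' ∧ w = w' ∧ z = z' := by
  simp [pack]

theorem pack_add (i : Fin 2) (u v w z u' v' w' z' : CircleFun) :
    pack i u v w z + pack i u' v' w' z' = pack i (u + u') (v + v') (w + w') (z + z') :=
  ((components i).symm.map_add _ _).symm

theorem pack_sub (i : Fin 2) (u v w z u' v' w' z' : CircleFun) :
    pack i u v w z - pack i u' v' w' z' = pack i (u - u') (v - v') (w - w') (z - z') :=
  ((components i).symm.map_sub _ _).symm

theorem pack_smul (i : Fin 2) (r : ℝ) (u v w z : CircleFun) :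
    r • pack i u v w z = pack i (r • u) (r • v) (r • w) (r • z) :=
  ((components i).symm.map_smul _ _).symm

theorem pack_mem_parity_zero {i : Fin 2} {u v w z : CircleFun} :
    pack i u v w z ∈ parity 0 ↔ v = 0 ∧ w = 0 := by
  change ((0 : ZMod 2) = 0 → _) ∧ ((0 : ZMod 2) = 1 → _) ↔ _
  fin_cases i
  · simp [pack_zero]
  · simp [pack_one, and_comm]

theorem pack_mem_parity_one {i : Fin 2} {u v w z : CircleFun} :
    pack i u v w z ∈ parity 1 ↔ u = 0 ∧ z = 0 := by
  change ((1 : ZMod 2) = 0 → _) ∧ ((1 : ZMod 2) = 1 → _) ↔ _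
  fin_cases i
  · simp [pack_zero]
  · simp [pack_one]

/-- The last two components are the first two with `lam` replaced by `lam + 1/2`, and the pairs do
not mix. The sums `lam + 1/2 + 1/2` are left unsimplified to keep this match literal. -/
theorem lieDensity_pack (i : Fin 2) (lam : ℝ) (f a u v w z : CircleFun) :
    lieDensity lam (pack i f a 0 0) (pack i u v w z) = pack i
      (f * circleDeriv u + lam • (circleDeriv f * u) + (1 / 2 : ℝ) • (a * v))
      (f * circleDeriv v + (lam + 1 / 2) • (circleDeriv f * v) +
        ((1 / 2 : ℝ) • (a * circleDeriv u) + lam • (circleDeriv a * u)))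
      (f * circleDeriv w + (lam + 1 / 2) • (circleDeriv f * w) + (1 / 2 : ℝ) • (a * z))
      (f * circleDeriv z + (lam + 1 / 2 + 1 / 2) • (circleDeriv f * z) +
        ((1 / 2 : ℝ) • (a * circleDeriv w) + (lam + 1 / 2) • (circleDeriv a * w))) := by
  have hh := halfFun_two
  fin_cases i
  · simp only [Fin.zero_eta, pack_zero]
    ext1 <;> simp [lieDensity, contactField_eq, Algebra.smul_def, -one_div] <;>
      rw [show algebraMap ℝ CircleFun (1 / 2) = halfFun from rfl]
    · ring
    · ring
    · ring
    · linear_combination (-(circleDeriv f * z)) * hh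
  · simp only [Fin.mk_one, pack_one]
    ext1 <;> simp [lieDensity, contactField_eq, Algebra.smul_def, -one_div] <;>
      rw [show algebraMap ℝ CircleFun (1 / 2) = halfFun from rfl]
    · ring
    · ring
    · ring
    · linear_combination (circleDeriv f * z) * hh

theorem contactBracket_pack (i : Fin 2) (f a g b : CircleFun) :
    contactBracket (pack i f a 0 0) (pack i g b 0 0) = pack i
      (f * circleDeriv g - circleDeriv f * g + (1 / 2 : ℝ) • (a * b))
      ((f * circleDeriv b - (1 / 2 : ℝ) • (circleDeriv f * b)) -
        (g * circleDeriv a - (1 / 2 : ℝ) • (circleDeriv g * a))) 0 0 := by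
  have hh := halfFun_two
  fin_cases i
  · simp only [Fin.zero_eta, pack_zero]
    ext1 <;> simp [contactBracket_eq, contactField_eq, Algebra.smul_def, -one_div] <;>
      rw [show algebraMap ℝ CircleFun (1 / 2) = halfFun from rfl]
    · ring
    · linear_combination (circleDeriv f * b) * hh
  · simp only [Fin.mk_one, pack_one]
    ext1 <;> simp [contactBracket_eq, contactField_eq, Algebra.smul_def, -one_div] <;>
      rw [show algebraMap ℝ CircleFun (1 / 2) = halfFun from rfl]
    · ring
    · linear_combination (circleDeriv f * b) * hh

end SuperFun

/-- The element `v_F` of `𝒦(1)ᵢ` with `F = f + a θᵢ`. -/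
def hamiltonian (i : Fin 2) : CircleFun × CircleFun →ₗ[ℝ] contactSub i where
  toFun p := ⟨pack i p.1 p.2 0 0, by
    fin_cases i
    · exact ⟨fun _ => rfl, fun h => absurd h (by decide), rfl⟩
    · exact ⟨fun h => absurd h (by decide), fun _ => rfl, neg_zero⟩⟩
  map_add' p q := Subtype.ext (by simp [pack_add])
  map_smul' r p := Subtype.ext (by simp [pack_smul])

theorem coe_hamiltonian (i : Fin 2) (f a : CircleFun) :
    (hamiltonian i (f, a) : SuperFun) = pack i f a 0 0 := rfl

theorem exists_eq_hamiltonian (i : Fin 2) (F : contactSub i) :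
    ∃ f a, F = hamiltonian i (f, a) := by
  obtain ⟨⟨f₀, f₁, f₂, f₁₂⟩, h0, h1, h2⟩ := F
  dsimp only at h0 h1 h2
  fin_cases i
  · exact ⟨f₀, f₁, Subtype.ext (by simp [coe_hamiltonian, pack_zero, h0, h2])⟩
  · exact ⟨f₀, f₂, Subtype.ext (by simp [coe_hamiltonian, pack_one, h1, h2])⟩

theorem contactSubBracket_hamiltonian (i : Fin 2) (f a g b : CircleFun) :
    contactSubBracket (hamiltonian i (f, a)) (hamiltonian i (g, b)) = hamiltonian i
      (f * circleDeriv g - circleDeriv f * g + (1 / 2 : ℝ) • (a * b),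
      (f * circleDeriv b - (1 / 2 : ℝ) • (circleDeriv f * b)) -
        (g * circleDeriv a - (1 / 2 : ℝ) • (circleDeriv g * a))) :=
  Subtype.ext (contactBracket_pack i f a g b)

/-- The cocycle condition for the even map `f + a θ ↦ A f + B a θ` from `𝒦(1)` to the densities of
weight `mu`. -/
structure IsEvenCocycle (mu : ℝ) (A B : CircleFun → CircleFun) : Prop where
  even_even : ∀ f g, A (f * circleDeriv g - circleDeriv f * g) =
    f * circleDeriv (A g) + mu • (circleDeriv f * A g)
      - (g * circleDeriv (A f) + mu • (circleDeriv g * A f))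
  even_odd : ∀ f a, B (f * circleDeriv a - (1 / 2 : ℝ) • (circleDeriv f * a)) =
    f * circleDeriv (B a) + (mu + 1 / 2) • (circleDeriv f * B a)
      - ((1 / 2 : ℝ) • (a * circleDeriv (A f)) + mu • (circleDeriv a * A f))
  odd_odd : ∀ a b, A ((1 / 2 : ℝ) • (a * b)) = (1 / 2 : ℝ) • (a * B b) + (1 / 2 : ℝ) • (b * B a)

/-- The cocycle condition for the odd map `f + a θ ↦ B a + A f θ` from `𝒦(1)` to the densities of
weight `mu`. -/
structure IsOddCocycle (mu : ℝ) (A B : CircleFun → CircleFun) : Prop where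
  even_even : ∀ f g, A (f * circleDeriv g - circleDeriv f * g) =
    f * circleDeriv (A g) + (mu + 1 / 2) • (circleDeriv f * A g)
      - (g * circleDeriv (A f) + (mu + 1 / 2) • (circleDeriv g * A f))
  even_odd : ∀ f a, B (f * circleDeriv a - (1 / 2 : ℝ) • (circleDeriv f * a)) =
    f * circleDeriv (B a) + mu • (circleDeriv f * B a) - (1 / 2 : ℝ) • (a * A f)
  odd_odd : ∀ a b, A ((1 / 2 : ℝ) • (a * b)) =
    (1 / 2 : ℝ) • (a * circleDeriv (B b)) + mu • (circleDeriv a * B b) +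
      ((1 / 2 : ℝ) • (b * circleDeriv (B a)) + mu • (circleDeriv b * B a))

/-! ### Reduction of cocycles to an even and an odd cocycle of weights `lam` and `lam + 1/2`. -/

theorem zmod_two_eq (p : ZMod 2) : p = 0 ∨ p = 1 := by
  revert p; decide

theorem neg_one_pow_val_mul_val (p q : ZMod 2) :
    (-1 : ℝ) ^ (p.val * q.val) = if p = 1 ∧ q = 1 then -1 else 1 := by
  obtain rfl | rfl := zmod_two_eq p <;> obtain rfl | rfl := zmod_two_eq q <;>
    simp [show (1 : ZMod 2).val = 1 from rfl]

theorem mem_cocycles_iff {i : Fin 2} {lam : ℝ} {b : ZMod 2} {c : contactSub i →ₗ[ℝ] SuperFun} :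
    c ∈ cocycles i lam b ↔
      (∀ f, c (hamiltonian i (f, 0)) ∈ parity b) ∧
      (∀ a, c (hamiltonian i (0, a)) ∈ parity (1 + b)) ∧
      (∀ f g, c (hamiltonian i (f * circleDeriv g - circleDeriv f * g, 0)) =
        lieDensity lam (pack i f 0 0 0) (c (hamiltonian i (g, 0)))
          - lieDensity lam (pack i g 0 0 0) (c (hamiltonian i (f, 0)))) ∧
      (∀ f a, c (hamiltonian i (0, f * circleDeriv a - (1 / 2 : ℝ) • (circleDeriv f * a))) =
        lieDensity lam (pack i f 0 0 0) (c (hamiltonian i (0, a)))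
          - lieDensity lam (pack i 0 a 0 0) (c (hamiltonian i (f, 0)))) ∧
      ∀ a b, c (hamiltonian i ((1 / 2 : ℝ) • (a * b), 0)) =
        lieDensity lam (pack i 0 a 0 0) (c (hamiltonian i (0, b)))
          + lieDensity lam (pack i 0 b 0 0) (c (hamiltonian i (0, a))) := by
  have even_mem : ∀ f, (hamiltonian i (f, 0) : SuperFun) ∈ parity 0 := fun f =>
    pack_mem_parity_zero.2 ⟨rfl, rfl⟩
  have odd_mem : ∀ a, (hamiltonian i (0, a) : SuperFun) ∈ parity 1 := fun a =>
    pack_mem_parity_one.2 ⟨rfl, rfl⟩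
  have even_of : ∀ F : contactSub i, (F : SuperFun) ∈ parity 0 → ∃ f, F = hamiltonian i (f, 0) :=
    fun F hF => by
      obtain ⟨f, a, rfl⟩ := exists_eq_hamiltonian i F
      have ha : a = 0 := (pack_mem_parity_zero.1 hF).1
      exact ⟨f, by rw [ha]⟩
  have odd_of : ∀ F : contactSub i, (F : SuperFun) ∈ parity 1 → ∃ a, F = hamiltonian i (0, a) :=
    fun F hF => by
      obtain ⟨f, a, rfl⟩ := exists_eq_hamiltonian i F
      have hf : f = 0 := (pack_mem_parity_one.1 hF).1
      exact ⟨a, by rw [hf]⟩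
  constructor
  · rintro ⟨hp, hc⟩
    refine ⟨fun f => by simpa using hp 0 _ (even_mem f), fun a => hp 1 _ (odd_mem a),
      fun f g => ?_, fun f a => ?_, fun a b => ?_⟩
    · have := hc 0 0 _ _ (even_mem f) (even_mem g)
      simpa [contactSubBracket_hamiltonian, coe_hamiltonian] using this
    · have := hc 0 1 _ _ (even_mem f) (odd_mem a)
      simpa [contactSubBracket_hamiltonian, coe_hamiltonian] using this
    · have := hc 1 1 _ _ (odd_mem a) (odd_mem b)
      rw [neg_one_pow_val_mul_val] at this
      simpa [contactSubBracket_hamiltonian, coe_hamiltonian] using this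
  · rintro ⟨hp, hp', h₁, h₂, h₃⟩
    refine ⟨fun p F hF => ?_, fun p q F G hF hG => ?_⟩
    · obtain rfl | rfl := zmod_two_eq p
      · obtain ⟨f, rfl⟩ := even_of F hF
        simpa using hp f
      · obtain ⟨a, rfl⟩ := odd_of F hF
        exact hp' a
    · rw [neg_one_pow_val_mul_val]
      obtain rfl | rfl := zmod_two_eq p <;> obtain rfl | rfl := zmod_two_eq q
      · obtain ⟨f, rfl⟩ := even_of F hF
        obtain ⟨g, rfl⟩ := even_of G hG
        simpa [contactSubBracket_hamiltonian, coe_hamiltonian] using h₁ f g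
      · obtain ⟨f, rfl⟩ := even_of F hF
        obtain ⟨a, rfl⟩ := odd_of G hG
        simpa [contactSubBracket_hamiltonian, coe_hamiltonian] using h₂ f a
      · obtain ⟨a, rfl⟩ := odd_of F hF
        obtain ⟨f, rfl⟩ := even_of G hG
        -- The odd-even case is the even-odd one by antisymmetry of the bracket.
        have h := congrArg Neg.neg (h₂ f a)
        rw [← map_neg, ← map_neg] at h
        simpa [contactSubBracket_hamiltonian, coe_hamiltonian] using h
      · obtain ⟨a, rfl⟩ := odd_of F hF
        obtain ⟨b, rfl⟩ := odd_of G hG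
        simpa [contactSubBracket_hamiltonian, coe_hamiltonian] using h₃ a b

theorem mem_cocycles_zero_iff {i : Fin 2} {lam : ℝ} {c : contactSub i →ₗ[ℝ] SuperFun}
    {A B A' B' : CircleFun →ₗ[ℝ] CircleFun}
    (hc : ∀ f a, c (hamiltonian i (f, a)) = pack i (A f) (B a) (B' a) (A' f)) :
    c ∈ cocycles i lam 0 ↔ IsEvenCocycle lam A B ∧ IsOddCocycle (lam + 1 / 2) A' B' := by
  rw [mem_cocycles_iff]
  simp only [hc, map_zero, lieDensity_pack, pack_add, pack_sub, pack_inj, pack_mem_parity_zero,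
    add_zero, zero_mul, mul_zero, smul_zero, zero_add, pack_mem_parity_one, sub_self,
    true_and, and_true, implies_true]
  constructor
  · rintro ⟨h₁, h₂, h₃⟩
    exact ⟨⟨fun f g => (h₁ f g).1, fun f a => (h₂ f a).1, fun a b => (h₃ a b).1⟩,
      ⟨fun f g => (h₁ f g).2, fun f a => (h₂ f a).2, fun a b => (h₃ a b).2⟩⟩
  · rintro ⟨h, h'⟩
    exact ⟨fun f g => ⟨h.1 f g, h'.1 f g⟩, fun f a => ⟨h.2 f a, h'.2 f a⟩,
      fun a b => ⟨h.3 a b, h'.3 a b⟩⟩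

/-- Compared with parity 0 the roles are exchanged: the odd cocycle has weight `lam` and the even
one `lam + 1/2`. The cocycle condition carries no sign depending on the parity of `c`, so the same
two systems occur. -/
theorem mem_cocycles_one_iff {i : Fin 2} {lam : ℝ} {c : contactSub i →ₗ[ℝ] SuperFun}
    {A B A' B' : CircleFun →ₗ[ℝ] CircleFun}
    (hc : ∀ f a, c (hamiltonian i (f, a)) = pack i (B' a) (A' f) (A f) (B a)) :
    c ∈ cocycles i lam 1 ↔ IsEvenCocycle (lam + 1 / 2) A B ∧ IsOddCocycle lam A' B' := by
  rw [mem_cocycles_iff, show (1 + 1 : ZMod 2) = 0 from rfl]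
  simp only [hc, map_zero, lieDensity_pack, pack_add, pack_sub, pack_inj, pack_mem_parity_zero,
    add_zero, zero_mul, mul_zero, smul_zero, zero_add, pack_mem_parity_one, sub_self,
    true_and, and_true, implies_true]
  constructor
  · rintro ⟨h₁, h₂, h₃⟩
    exact ⟨⟨fun f g => (h₁ f g).2, fun f a => (h₂ f a).2, fun a b => (h₃ a b).2⟩,
      ⟨fun f g => (h₁ f g).1, fun f a => (h₂ f a).1, fun a b => (h₃ a b).1⟩⟩
  · rintro ⟨h, h'⟩
    exact ⟨fun f g => ⟨h'.1 f g, h.1 f g⟩, fun f a => ⟨h'.2 f a, h.2 f a⟩,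
      fun a b => ⟨h'.3 a b, h.3 a b⟩⟩

theorem exists_components (i : Fin 2) (c : contactSub i →ₗ[ℝ] SuperFun) :
    ∃ X Y : Fin 4 → CircleFun →ₗ[ℝ] CircleFun,
      (∀ f, c (hamiltonian i (f, 0)) = pack i (X 0 f) (X 1 f) (X 2 f) (X 3 f)) ∧
      ∀ a, c (hamiltonian i (0, a)) = pack i (Y 0 a) (Y 1 a) (Y 2 a) (Y 3 a) := by
  let T : CircleFun × CircleFun →ₗ[ℝ] CircleFun × CircleFun × CircleFun × CircleFun :=
    (components i).toLinearMap ∘ₗ c ∘ₗ hamiltonian i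
  let π : Fin 4 → CircleFun × CircleFun × CircleFun × CircleFun →ₗ[ℝ] CircleFun :=
    ![LinearMap.fst ℝ _ _, LinearMap.fst ℝ _ _ ∘ₗ LinearMap.snd ℝ _ _,
      LinearMap.fst ℝ _ _ ∘ₗ LinearMap.snd ℝ _ _ ∘ₗ LinearMap.snd ℝ _ _,
      LinearMap.snd ℝ _ _ ∘ₗ LinearMap.snd ℝ _ _ ∘ₗ LinearMap.snd ℝ _ _]
  exact ⟨fun k => π k ∘ₗ T ∘ₗ LinearMap.inl ℝ _ _, fun k => π k ∘ₗ T ∘ₗ LinearMap.inr ℝ _ _,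
    fun f => ((components i).symm_apply_apply _).symm,
    fun a => ((components i).symm_apply_apply _).symm⟩

theorem hamiltonian_eq_add (i : Fin 2) (f a : CircleFun) :
    hamiltonian i (f, a) = hamiltonian i (f, 0) + hamiltonian i (0, a) := by
  rw [← map_add, Prod.mk_add_mk, add_zero, zero_add]

theorem exists_of_mem_cocycles_zero {i : Fin 2} {lam : ℝ} {c : contactSub i →ₗ[ℝ] SuperFun}
    (hc : c ∈ cocycles i lam 0) : ∃ A B A' B' : CircleFun →ₗ[ℝ] CircleFun,
      (∀ f a, c (hamiltonian i (f, a)) = pack i (A f) (B a) (B' a) (A' f)) ∧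
      IsEvenCocycle lam A B ∧ IsOddCocycle (lam + 1 / 2) A' B' := by
  obtain ⟨X, Y, hX, hY⟩ := exists_components i c
  have h : ∀ f a, c (hamiltonian i (f, a)) = pack i (X 0 f) (Y 1 a) (Y 2 a) (X 3 f) :=
    fun f a => by
      have h₁ := (mem_cocycles_iff.1 hc).1 f
      have h₂ := (mem_cocycles_iff.1 hc).2.1 a
      rw [hX, pack_mem_parity_zero] at h₁
      rw [hY, add_zero, pack_mem_parity_one] at h₂
      rw [hamiltonian_eq_add, map_add, hX, hY, pack_add, h₁.1, h₁.2, h₂.1, h₂.2]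
      simp only [add_zero, zero_add]
  exact ⟨_, _, _, _, h, (mem_cocycles_zero_iff h).1 hc⟩

theorem exists_of_mem_cocycles_one {i : Fin 2} {lam : ℝ} {c : contactSub i →ₗ[ℝ] SuperFun}
    (hc : c ∈ cocycles i lam 1) : ∃ A B A' B' : CircleFun →ₗ[ℝ] CircleFun,
      (∀ f a, c (hamiltonian i (f, a)) = pack i (B' a) (A' f) (A f) (B a)) ∧
      IsEvenCocycle (lam + 1 / 2) A B ∧ IsOddCocycle lam A' B' := by
  obtain ⟨X, Y, hX, hY⟩ := exists_components i c
  have h : ∀ f a, c (hamiltonian i (f, a)) = pack i (Y 0 a) (X 1 f) (X 2 f) (Y 3 a) :=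
    fun f a => by
      have h₁ := (mem_cocycles_iff.1 hc).1 f
      have h₂ := (mem_cocycles_iff.1 hc).2.1 a
      rw [hX, pack_mem_parity_one] at h₁
      rw [hY, show (1 + 1 : ZMod 2) = 0 from rfl, pack_mem_parity_zero] at h₂
      rw [hamiltonian_eq_add, map_add, hX, hY, pack_add, h₁.1, h₁.2, h₂.1, h₂.2]
      simp only [add_zero, zero_add]
  exact ⟨_, _, _, _, h, (mem_cocycles_one_iff h).1 hc⟩

theorem mem_coboundaries_iff {i : Fin 2} {lam : ℝ} {c : contactSub i →ₗ[ℝ] SuperFun} :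
    c ∈ coboundaries i lam ↔ ∃ u v w z, ∀ f a, c (hamiltonian i (f, a)) =
      lieDensity lam (pack i f a 0 0) (pack i u v w z) := by
  constructor
  · rintro ⟨m, hm⟩
    obtain ⟨u, v, w, z, rfl⟩ := exists_eq_pack i m
    exact ⟨u, v, w, z, fun f a => hm _⟩
  · rintro ⟨u, v, w, z, h⟩
    refine ⟨pack i u v w z, fun F => ?_⟩
    obtain ⟨f, a, rfl⟩ := exists_eq_hamiltonian i F
    exact h f a

theorem isCohomologyBasis_of {i : Fin 2} {lam : ℝ} {b : ZMod 2} {n : ℕ}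
    {c : Fin n → contactSub i →ₗ[ℝ] SuperFun} (h : ∀ k, c k ∈ cocycles i lam b)
    (hli : ∀ r : Fin n → ℝ, ∑ k, r k • c k ∈ coboundaries i lam → r = 0)
    (hsp : ∀ d ∈ cocycles i lam b, ∃ r : Fin n → ℝ, d - ∑ k, r k • c k ∈ coboundaries i lam) :
    IsCohomologyBasis i lam b c := by
  let v : Fin n → H1 i lam b := fun k => Submodule.Quotient.mk ⟨c k, h k⟩
  have hv : ∀ r : Fin n → ℝ, ∑ k, r k • v k =
      Submodule.Quotient.mk (∑ k, r k • ⟨c k, h k⟩) := fun r => by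
    simp only [v, ← Submodule.mkQ_apply, map_sum, map_smul]
  have hcoe : ∀ r : Fin n → ℝ, ((∑ k, r k • ⟨c k, h k⟩ : cocycles i lam b) :
      contactSub i →ₗ[ℝ] SuperFun) = ∑ k, r k • c k := fun r => by
    simp
  have li : LinearIndependent ℝ v := Fintype.linearIndependent_iff.2 fun r hr => by
    rw [hv, Submodule.Quotient.mk_eq_zero, Submodule.mem_comap, Submodule.subtype_apply,
      hcoe] at hr
    exact congrFun (hli r hr)
  have sp : ⊤ ≤ Submodule.span ℝ (Set.range v) := by
    rintro x -
    obtain ⟨⟨d, hd⟩, rfl⟩ := Submodule.Quotient.mk_surjective _ x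
    obtain ⟨r, hr⟩ := hsp d hd
    have hx : (Submodule.Quotient.mk ⟨d, hd⟩ : H1 i lam b) = ∑ k, r k • v k := by
      rw [hv, Submodule.Quotient.eq, Submodule.mem_comap, Submodule.subtype_apply,
        AddSubgroupClass.coe_sub, hcoe]
      exact hr
    rw [hx]
    exact Submodule.sum_mem _ fun k _ =>
      Submodule.smul_mem _ _ (Submodule.subset_span (Set.mem_range_self k))
  exact ⟨h, .mk li sp, fun k => Module.Basis.mk_apply li sp k⟩

theorem IsCohomologyBasis.nonempty_equiv {i : Fin 2} {lam : ℝ} {b : ZMod 2} {n m : ℕ}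
    {c : Fin n → contactSub i →ₗ[ℝ] SuperFun} (h : IsCohomologyBasis i lam b c) (hm : m = n) :
    Nonempty (H1 i lam b ≃ₗ[ℝ] (Fin m → ℝ)) := by
  obtain ⟨-, B, -⟩ := h
  subst hm
  exact ⟨B.equivFun⟩

/-! ### The cocycles `C0` to `C7` in components. -/

section Values

variable (i : Fin 2) (f a : CircleFun)

theorem C0_hamiltonian : C0 i (hamiltonian i (f, a)) = pack i f ((1 / 2 : ℝ) • a) 0 0 := by
  change (1 / 4 : ℝ) • ((3 : ℝ) • pack i f a 0 0 + signed (pack i f a 0 0)) = _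
  fin_cases i
  · simp only [Fin.zero_eta, pack_zero]
    ext1 <;> simp <;> module
  · simp only [Fin.mk_one, pack_one]
    ext1 <;> simp <;> module

theorem C1_hamiltonian :
    C1 i (hamiltonian i (f, a)) = pack i (circleDeriv f) (circleDeriv a) 0 0 := by
  change dx (pack i f a 0 0) = _
  fin_cases i
  · simp only [Fin.zero_eta, pack_zero]
    ext1 <;> simp
  · simp only [Fin.mk_one, pack_one]
    ext1 <;> simp

theorem etaBar_mul_thetaOther :
    etaBar i (pack i f a 0 0) * thetaOther i = pack i 0 0 a (circleDeriv f) := by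
  fin_cases i
  · simp only [Fin.zero_eta, pack_zero]
    ext1 <;> simp [etaBar_zero, thetaOther, theta]
  · simp only [Fin.mk_one, pack_one]
    ext1 <;> simp [etaBar_one, thetaOther, theta]

theorem etaBar_pack : etaBar i (pack i f a 0 0) = pack i a (circleDeriv f) 0 0 := by
  fin_cases i
  · simp only [Fin.zero_eta, pack_zero]
    ext1 <;> simp [etaBar_zero]
  · simp only [Fin.mk_one, pack_one]
    ext1 <;> simp [etaBar_one]

theorem pack_mul_thetaOther : pack i f a 0 0 * thetaOther i = pack i 0 0 f a := by
  fin_cases i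
  · simp only [Fin.zero_eta, pack_zero]
    ext1 <;> simp [thetaOther, theta]
  · simp only [Fin.mk_one, pack_one]
    ext1 <;> simp [thetaOther, theta]

theorem dx_pack : dx (pack i f a 0 0) = pack i (circleDeriv f) (circleDeriv a) 0 0 :=
  C1_hamiltonian i f a

theorem C2_hamiltonian : C2 i (hamiltonian i (f, a)) =
    pack i 0 0 (circleDeriv a) (circleDeriv (circleDeriv f)) := by
  change etaBar i (dx (pack i f a 0 0)) * thetaOther i = _
  rw [dx_pack, etaBar_mul_thetaOther]

theorem C3_hamiltonian : C3 i (hamiltonian i (f, a)) =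
    pack i 0 0 (circleDeriv (circleDeriv a)) (circleDeriv (circleDeriv (circleDeriv f))) := by
  change etaBar i (dx (dx (pack i f a 0 0))) * thetaOther i = _
  rw [dx_pack, dx_pack, etaBar_mul_thetaOther]

theorem C4_hamiltonian : C4 i (hamiltonian i (f, a)) = pack i 0 0 f ((1 / 2 : ℝ) • a) := by
  change C0 i (hamiltonian i (f, a)) * thetaOther i = _
  rw [C0_hamiltonian, pack_mul_thetaOther]

theorem C5_hamiltonian :
    C5 i (hamiltonian i (f, a)) = pack i 0 0 (circleDeriv f) (circleDeriv a) := by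
  change dx (pack i f a 0 0) * thetaOther i = _
  rw [dx_pack, pack_mul_thetaOther]

theorem C6_hamiltonian : C6 i (hamiltonian i (f, a)) =
    pack i (circleDeriv a) (circleDeriv (circleDeriv f)) 0 0 := by
  change etaBar i (dx (pack i f a 0 0)) = _
  rw [dx_pack, etaBar_pack]

theorem C7_hamiltonian : C7 i (hamiltonian i (f, a)) =
    pack i (circleDeriv (circleDeriv a)) (circleDeriv (circleDeriv (circleDeriv f))) 0 0 := by
  change etaBar i (dx (dx (pack i f a 0 0))) = _
  rw [dx_pack, dx_pack, etaBar_pack]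

end Values

theorem isEvenCocycle_zero (mu : ℝ) : IsEvenCocycle mu (0 : CircleFun →ₗ[ℝ] CircleFun)
    (0 : CircleFun →ₗ[ℝ] CircleFun) := by
  constructor <;> simp

theorem isOddCocycle_zero (mu : ℝ) : IsOddCocycle mu (0 : CircleFun →ₗ[ℝ] CircleFun)
    (0 : CircleFun →ₗ[ℝ] CircleFun) := by
  constructor <;> simp

theorem isEvenCocycle_id : IsEvenCocycle 0 (LinearMap.id : CircleFun →ₗ[ℝ] CircleFun)
    ((1 / 2 : ℝ) • LinearMap.id : CircleFun →ₗ[ℝ] CircleFun) := by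
  constructor <;> intro f g <;>
    simp only [LinearMap.id_apply, LinearMap.smul_apply, Derivation.map_smul, zero_smul, zero_add] <;>
    (try simp only [Algebra.smul_def, show algebraMap ℝ CircleFun (1 / 2) = halfFun from rfl])
  · ring
  · linear_combination -(halfFun * circleDeriv f * g) * halfFun_two
  · linear_combination (-halfFun * f * g) * halfFun_two

theorem isEvenCocycle_circleDeriv : IsEvenCocycle 0 circleDeriv.toLinearMap
    circleDeriv.toLinearMap := by
  constructor <;> intro f g <;>
    simp only [Derivation.coeFn_coe, map_sub, Derivation.map_smul, circleDeriv_mul, zero_smul,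
      zero_add] <;>
    (try simp only [Algebra.smul_def, show algebraMap ℝ CircleFun (1 / 2) = halfFun from rfl])
  · ring
  · linear_combination -(circleDeriv f * circleDeriv g) * halfFun_two
  · ring

theorem isOddCocycle_circleDeriv : IsOddCocycle (1 / 2)
    (circleDeriv.toLinearMap ∘ₗ circleDeriv.toLinearMap) circleDeriv.toLinearMap := by
  have h1 : (1 / 2 + 1 / 2 : ℝ) = 1 := by norm_num
  constructor <;> intro f g <;>
    simp only [LinearMap.comp_apply, Derivation.coeFn_coe, map_sub, map_add, Derivation.map_smul,
      circleDeriv_mul, h1, one_smul] <;>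
    (try simp only [Algebra.smul_def, show algebraMap ℝ CircleFun (1 / 2) = halfFun from rfl])
  · ring
  · linear_combination -(circleDeriv f * circleDeriv g) * halfFun_two
  · ring

theorem isOddCocycle_circleDeriv_circleDeriv : IsOddCocycle (3 / 2)
    (circleDeriv.toLinearMap ∘ₗ circleDeriv.toLinearMap ∘ₗ circleDeriv.toLinearMap)
    (circleDeriv.toLinearMap ∘ₗ circleDeriv.toLinearMap) := by
  have h2 : (3 / 2 : ℝ) = 1 + 1 / 2 := by norm_num
  constructor <;> intro f g <;>
    simp only [LinearMap.comp_apply, Derivation.coeFn_coe, map_sub, map_add, Derivation.map_smul,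
      circleDeriv_mul, h2, one_smul, add_smul] <;>
    (try simp only [Algebra.smul_def, show algebraMap ℝ CircleFun (1 / 2) = halfFun from rfl])
  · linear_combination (circleDeriv g * circleDeriv (circleDeriv (circleDeriv f)) -
      circleDeriv (circleDeriv (circleDeriv g)) * circleDeriv f) * halfFun_two
  · linear_combination -(circleDeriv (circleDeriv g) * circleDeriv f +
      circleDeriv g * circleDeriv (circleDeriv f)) * halfFun_two
  · linear_combination (circleDeriv (circleDeriv g) * circleDeriv f +
      circleDeriv g * circleDeriv (circleDeriv f)) * halfFun_two

/-! ### Every cocycle is a coboundary plus a combination of the listed ones. -/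

/-- The terms in `u` are the coboundary of the density `u`. For `mu ≠ 0` the relation `e' = mu k`
gives `u = e / mu`; for `mu = 0`, `e` is the constant `s` and `k = r + u'`. -/
theorem IsEvenCocycle.exists_eq {mu : ℝ} {A B : CircleFun →ₗ[ℝ] CircleFun}
    (h : IsEvenCocycle mu A B) : ∃ (u : CircleFun) (r s : ℝ),
      (∀ f, A f = f * circleDeriv u + mu • (circleDeriv f * u) + (r • f + s • circleDeriv f)) ∧
      (∀ a, B a = (1 / 2 : ℝ) • (a * circleDeriv u) + mu • (circleDeriv a * u) +
        (r • (1 / 2 : ℝ) • a + s • circleDeriv a)) ∧ (mu ≠ 0 → r = 0 ∧ s = 0) := by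
  have h₂ : ∀ a b, A (a * b) = a * B b + b * B a := fun a b => by
    have := h.odd_odd a b
    rw [map_smul, ← smul_add] at this
    exact smul_right_injective CircleFun (by norm_num : (1 / 2 : ℝ) ≠ 0) this
  obtain ⟨e, k, hA, hB, he⟩ := exists_of_even_cocycle h.even_even h₂
  by_cases hmu : mu = 0
  · subst hmu
    rw [zero_smul] at he
    obtain ⟨s, rfl⟩ := exists_eq_algebraMap_of_circleDeriv_eq_zero he
    obtain ⟨r, u, rfl⟩ := exists_eq_algebraMap_add_circleDeriv k
    refine ⟨u, r, s, fun f => ?_, fun a => ?_, fun h => absurd rfl h⟩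
    · rw [hA, zero_smul, Algebra.smul_def, Algebra.smul_def]; ring
    · rw [hB, zero_smul]
      simp only [Algebra.smul_def]; ring
  · have hk : k = circleDeriv (mu⁻¹ • e) := by rw [Derivation.map_smul, he, inv_smul_smul₀ hmu]
    have hu : e = mu • mu⁻¹ • e := (smul_inv_smul₀ hmu e).symm
    generalize mu⁻¹ • e = u at hk hu
    subst hk hu
    refine ⟨u, 0, 0, fun f => ?_, fun a => ?_, fun _ => ⟨rfl, rfl⟩⟩
    · rw [hA]; simp only [Algebra.smul_def, map_zero]; ring
    · rw [hB]; simp only [Algebra.smul_def, map_zero]; ring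

theorem IsOddCocycle.exists_eq {mu : ℝ} {A B : CircleFun →ₗ[ℝ] CircleFun}
    (h : IsOddCocycle mu A B) : ∃ (z : CircleFun) (p q : ℝ),
      (∀ a, B a = (1 / 2 : ℝ) • (a * z) +
        (p • circleDeriv a + q • circleDeriv (circleDeriv a))) ∧
      (∀ f, A f = f * circleDeriv z + (mu + 1 / 2) • (circleDeriv f * z) +
        (p • circleDeriv (circleDeriv f) + q • circleDeriv (circleDeriv (circleDeriv f)))) ∧
      (mu ≠ 1 / 2 → p = 0) ∧ (mu ≠ 3 / 2 → q = 0) := by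
  have h₂ : ∀ a b, A (a * b) = a * circleDeriv (B b) + b * circleDeriv (B a) +
      (2 * mu) • (circleDeriv a * B b + circleDeriv b * B a) := fun a b => by
    have := h.odd_odd a b
    rw [map_smul] at this
    refine smul_right_injective CircleFun (by norm_num : (1 / 2 : ℝ) ≠ 0) (this.trans ?_)
    dsimp only
    module
  obtain ⟨w, p, q, hB, hA, hp, hq⟩ := exists_of_odd_cocycle h.even_odd h₂
  -- The odd element `a θ` sends the density `z θ` to `a z / 2`, so multiplication by `w` is the
  -- coboundary of `2 w θ`.
  refine ⟨(2 : ℝ) • w, p, q, fun a => ?_, fun f => ?_, fun hmu => ?_, fun hmu => ?_⟩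
  · rw [hB, mul_smul_comm, smul_smul, mul_comm a]
    norm_num [add_assoc]
  · rw [hA, Derivation.map_smul, mul_smul_comm, mul_smul_comm, two_mul]
    module
  · exact (mul_eq_zero.1 hp).resolve_right fun h => hmu (by linarith)
  · exact (mul_eq_zero.1 hq).resolve_right fun h => hmu (by linarith)

theorem exists_sub_mem_coboundaries_zero {i : Fin 2} {lam : ℝ} {c : contactSub i →ₗ[ℝ] SuperFun}
    (hc : c ∈ cocycles i lam 0) : ∃ r s p q : ℝ,
      c - (r • C0 i + s • C1 i + p • C2 i + q • C3 i) ∈ coboundaries i lam ∧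
      (lam ≠ 0 → r = 0 ∧ s = 0 ∧ p = 0) ∧ (lam ≠ 1 → q = 0) := by
  obtain ⟨A, B, A', B', hc, h, h'⟩ := exists_of_mem_cocycles_zero hc
  obtain ⟨u, r, s, hA, hB, hr⟩ := h.exists_eq
  obtain ⟨z, p, q, hB', hA', hp, hq⟩ := h'.exists_eq
  refine ⟨r, s, p, q, mem_coboundaries_iff.2 ⟨u, 0, 0, z, fun f a => ?_⟩, fun h0 =>
    ⟨(hr h0).1, (hr h0).2, hp fun h => h0 (by linarith)⟩, fun h1 => hq fun h => h1 (by linarith)⟩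
  simp only [LinearMap.sub_apply, LinearMap.add_apply, LinearMap.smul_apply, hc, C0_hamiltonian,
    C1_hamiltonian, C2_hamiltonian, C3_hamiltonian, pack_smul, pack_add, pack_sub, lieDensity_pack,
    hA, hB, hA', hB', map_zero, mul_zero, smul_zero, add_zero, zero_add,
    add_sub_cancel_right]

theorem exists_sub_mem_coboundaries_one {i : Fin 2} {lam : ℝ} {c : contactSub i →ₗ[ℝ] SuperFun}
    (hc : c ∈ cocycles i lam 1) : ∃ r s p q : ℝ,
      c - (r • C4 i + s • C5 i + p • C6 i + q • C7 i) ∈ coboundaries i lam ∧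
      (lam ≠ -1 / 2 → r = 0 ∧ s = 0) ∧ (lam ≠ 1 / 2 → p = 0) ∧ (lam ≠ 3 / 2 → q = 0) := by
  obtain ⟨A, B, A', B', hc, h, h'⟩ := exists_of_mem_cocycles_one hc
  obtain ⟨u, r, s, hA, hB, hr⟩ := h.exists_eq
  obtain ⟨z, p, q, hB', hA', hp, hq⟩ := h'.exists_eq
  refine ⟨r, s, p, q, mem_coboundaries_iff.2 ⟨0, z, u, 0, fun f a => ?_⟩, fun h0 =>
    hr fun h => h0 (by linarith), hp, hq⟩
  simp only [LinearMap.sub_apply, LinearMap.add_apply, LinearMap.smul_apply, hc, C4_hamiltonian,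
    C5_hamiltonian, C6_hamiltonian, C7_hamiltonian, pack_smul, pack_add, pack_sub, lieDensity_pack,
    hA, hB, hA', hB', map_zero, mul_zero, smul_zero, add_zero, zero_add,
    add_sub_cancel_right]

theorem C0_mem_cocycles (i : Fin 2) : C0 i ∈ cocycles i 0 0 :=
  (mem_cocycles_zero_iff (C0_hamiltonian i)).2 ⟨isEvenCocycle_id, isOddCocycle_zero _⟩

theorem C1_mem_cocycles (i : Fin 2) : C1 i ∈ cocycles i 0 0 :=
  (mem_cocycles_zero_iff (C1_hamiltonian i)).2 ⟨isEvenCocycle_circleDeriv, isOddCocycle_zero _⟩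

theorem C2_mem_cocycles (i : Fin 2) : C2 i ∈ cocycles i 0 0 :=
  (mem_cocycles_zero_iff (C2_hamiltonian i)).2
    ⟨isEvenCocycle_zero _, by rw [zero_add]; exact isOddCocycle_circleDeriv⟩

theorem C3_mem_cocycles (i : Fin 2) : C3 i ∈ cocycles i 1 0 :=
  (mem_cocycles_zero_iff (C3_hamiltonian i)).2 ⟨isEvenCocycle_zero _, by
    rw [show (1 + 1 / 2 : ℝ) = 3 / 2 by norm_num]; exact isOddCocycle_circleDeriv_circleDeriv⟩

theorem C4_mem_cocycles (i : Fin 2) : C4 i ∈ cocycles i (-1 / 2) 1 :=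
  (mem_cocycles_one_iff (C4_hamiltonian i)).2 ⟨by
    rw [show (-1 / 2 + 1 / 2 : ℝ) = 0 by norm_num]; exact isEvenCocycle_id, isOddCocycle_zero _⟩

theorem C5_mem_cocycles (i : Fin 2) : C5 i ∈ cocycles i (-1 / 2) 1 :=
  (mem_cocycles_one_iff (C5_hamiltonian i)).2 ⟨by
    rw [show (-1 / 2 + 1 / 2 : ℝ) = 0 by norm_num]; exact isEvenCocycle_circleDeriv,
    isOddCocycle_zero _⟩

theorem C6_mem_cocycles (i : Fin 2) : C6 i ∈ cocycles i (1 / 2) 1 :=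
  (mem_cocycles_one_iff (C6_hamiltonian i)).2 ⟨isEvenCocycle_zero _, isOddCocycle_circleDeriv⟩

theorem C7_mem_cocycles (i : Fin 2) : C7 i ∈ cocycles i (3 / 2) 1 :=
  (mem_cocycles_one_iff (C7_hamiltonian i)).2
    ⟨isEvenCocycle_zero _, isOddCocycle_circleDeriv_circleDeriv⟩

/-! ### Independence of the classes. -/

/-- At `f = 1` the constant `r` is the derivative of a periodic function, hence 0; then `u' = 0`,
and `f = sin` at 0 reads off `s`. -/
theorem eq_zero_of_coboundary_even {r s : ℝ} {u : CircleFun}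
    (h : ∀ f, r • f + s • circleDeriv f = f * circleDeriv u) : r = 0 ∧ s = 0 := by
  have h1 := h 1
  rw [Derivation.map_one_eq_zero, smul_zero, add_zero, one_mul, Algebra.smul_def, mul_one] at h1
  obtain rfl := eq_zero_of_algebraMap_eq_circleDeriv h1
  refine ⟨rfl, ?_⟩
  have h2 := h sin
  rw [← h1, zero_smul, zero_add, map_zero, mul_zero, circleDeriv_sin] at h2
  simpa [smul_apply, cos_apply, zero_apply] using congrArg (fun g : CircleFun => g 0) h2

/-- At `a = 1` the left side vanishes, so `z = 0`; then `a = sin`, evaluated at 0 and `π / 2`,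
separates `p` from `q`. -/
theorem eq_zero_of_coboundary_odd {p q : ℝ} {z : CircleFun}
    (h : ∀ a, p • circleDeriv a + q • circleDeriv (circleDeriv a) = (1 / 2 : ℝ) • (a * z)) :
    p = 0 ∧ q = 0 := by
  have h1 := h 1
  rw [Derivation.map_one_eq_zero, map_zero, smul_zero, smul_zero, add_zero, one_mul] at h1
  have hz : z = 0 := (smul_eq_zero.1 h1.symm).resolve_left (by norm_num)
  have h2 := h sin
  rw [hz, mul_zero, smul_zero, circleDeriv_sin, circleDeriv_cos] at h2
  have e1 := congrArg (fun g : CircleFun => g 0) h2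
  have e2 := congrArg (fun g : CircleFun => g (Real.pi / 2)) h2
  simp [add_apply, neg_apply, smul_apply, cos_apply, sin_apply, zero_apply] at e1 e2
  exact ⟨e1, e2⟩

theorem eq_zero_of_mem_coboundaries_zero {i : Fin 2} {lam r s p q : ℝ}
    (h : r • C0 i + s • C1 i + p • C2 i + q • C3 i ∈ coboundaries i lam)
    (h0 : lam ≠ 0 → r = 0 ∧ s = 0) : r = 0 ∧ s = 0 ∧ p = 0 ∧ q = 0 := by
  obtain ⟨u, v, w, z, h⟩ := mem_coboundaries_iff.1 h
  simp only [LinearMap.add_apply, LinearMap.smul_apply, C0_hamiltonian, C1_hamiltonian,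
    C2_hamiltonian, C3_hamiltonian, pack_smul, pack_add, lieDensity_pack, pack_inj] at h
  have hpq : p = 0 ∧ q = 0 := eq_zero_of_coboundary_odd (z := z) fun a => by
    simpa using (h 0 a).2.2.1
  by_cases hl : lam = 0
  · have hrs : r = 0 ∧ s = 0 := eq_zero_of_coboundary_even (u := u) fun f => by
      simpa [hl] using (h f 0).1
    exact ⟨hrs.1, hrs.2, hpq⟩
  · exact ⟨(h0 hl).1, (h0 hl).2, hpq⟩

theorem eq_zero_of_mem_coboundaries_one {i : Fin 2} {lam r s p q : ℝ}
    (h : r • C4 i + s • C5 i + p • C6 i + q • C7 i ∈ coboundaries i lam)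
    (h0 : lam ≠ -1 / 2 → r = 0 ∧ s = 0) : r = 0 ∧ s = 0 ∧ p = 0 ∧ q = 0 := by
  obtain ⟨u, v, w, z, h⟩ := mem_coboundaries_iff.1 h
  simp only [LinearMap.add_apply, LinearMap.smul_apply, C4_hamiltonian, C5_hamiltonian,
    C6_hamiltonian, C7_hamiltonian, pack_smul, pack_add, lieDensity_pack, pack_inj] at h
  have hpq : p = 0 ∧ q = 0 := eq_zero_of_coboundary_odd (z := v) fun a => by
    simpa using (h 0 a).1
  by_cases hl : lam = -1 / 2
  · have hl' : lam + 1 / 2 = 0 := by rw [hl]; norm_num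
    have hrs : r = 0 ∧ s = 0 := eq_zero_of_coboundary_even (u := w) fun f => by
      simpa [hl', -one_div] using (h f 0).2.2.1
    exact ⟨hrs.1, hrs.2, hpq⟩
  · exact ⟨(h0 hl).1, (h0 hl).2, hpq⟩

/-! ### Bases weight by weight, and the theorem. -/

theorem isCohomologyBasis_zero_zero (i : Fin 2) : IsCohomologyBasis i 0 0 ![C0 i, C1 i, C2 i] := by
  refine isCohomologyBasis_of (fun k => ?_) (fun r hr => ?_) fun d hd => ?_
  · fin_cases k
    exacts [C0_mem_cocycles i, C1_mem_cocycles i, C2_mem_cocycles i]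
  · obtain ⟨h0, h1, h2, -⟩ := eq_zero_of_mem_coboundaries_zero (i := i) (lam := 0) (r := r 0)
      (s := r 1) (p := r 2) (q := 0) (by simpa [Fin.sum_univ_three] using hr)
      fun h => absurd rfl h
    ext k; fin_cases k
    exacts [h0, h1, h2]
  · obtain ⟨r, s, p, q, h, -, hq⟩ := exists_sub_mem_coboundaries_zero hd
    exact ⟨![r, s, p], by simpa [Fin.sum_univ_three, hq] using h⟩

theorem isCohomologyBasis_one_zero (i : Fin 2) : IsCohomologyBasis i 1 0 ![C3 i] := by
  refine isCohomologyBasis_of (fun k => ?_) (fun r hr => ?_) fun d hd => ?_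
  · fin_cases k
    exact C3_mem_cocycles i
  · obtain ⟨-, -, -, h3⟩ := eq_zero_of_mem_coboundaries_zero (i := i) (lam := 1) (r := 0)
      (s := 0) (p := 0) (q := r 0) (by simpa using hr) fun _ => ⟨rfl, rfl⟩
    ext k; fin_cases k
    exact h3
  · obtain ⟨r, s, p, q, h, h0, -⟩ := exists_sub_mem_coboundaries_zero hd
    obtain ⟨rfl, rfl, rfl⟩ := h0 one_ne_zero
    exact ⟨![q], by simpa using h⟩

theorem isCohomologyBasis_empty_zero (i : Fin 2) {lam : ℝ} (h₀ : lam ≠ 0) (h₁ : lam ≠ 1) :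
    IsCohomologyBasis i lam 0 ![] := by
  refine isCohomologyBasis_of (fun k => k.elim0) (fun r _ => Subsingleton.elim _ _) fun d hd => ?_
  obtain ⟨r, s, p, q, h, h0, hq⟩ := exists_sub_mem_coboundaries_zero hd
  obtain ⟨rfl, rfl, rfl⟩ := h0 h₀
  rw [hq h₁] at h
  exact ⟨![], by simpa using h⟩

theorem isCohomologyBasis_neg_half_one (i : Fin 2) :
    IsCohomologyBasis i (-1 / 2) 1 ![C4 i, C5 i] := by
  refine isCohomologyBasis_of (fun k => ?_) (fun r hr => ?_) fun d hd => ?_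
  · fin_cases k
    exacts [C4_mem_cocycles i, C5_mem_cocycles i]
  · obtain ⟨h0, h1, -⟩ := eq_zero_of_mem_coboundaries_one (i := i) (lam := -1 / 2) (r := r 0)
      (s := r 1) (p := 0) (q := 0) (by simpa [Fin.sum_univ_two] using hr) fun h => absurd rfl h
    ext k; fin_cases k
    exacts [h0, h1]
  · obtain ⟨r, s, p, q, h, -, hp, hq⟩ := exists_sub_mem_coboundaries_one hd
    rw [hp (by norm_num), hq (by norm_num)] at h
    exact ⟨![r, s], by simpa [Fin.sum_univ_two] using h⟩

theorem isCohomologyBasis_half_one (i : Fin 2) : IsCohomologyBasis i (1 / 2) 1 ![C6 i] := by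
  refine isCohomologyBasis_of (fun k => ?_) (fun r hr => ?_) fun d hd => ?_
  · fin_cases k
    exact C6_mem_cocycles i
  · obtain ⟨-, -, h2, -⟩ := eq_zero_of_mem_coboundaries_one (i := i) (lam := 1 / 2) (r := 0)
      (s := 0) (p := r 0) (q := 0) (by simpa using hr) fun _ => ⟨rfl, rfl⟩
    ext k; fin_cases k
    exact h2
  · obtain ⟨r, s, p, q, h, h0, -, hq⟩ := exists_sub_mem_coboundaries_one hd
    rw [(h0 (by norm_num)).1, (h0 (by norm_num)).2, hq (by norm_num)] at h
    exact ⟨![p], by simpa using h⟩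

theorem isCohomologyBasis_three_halves_one (i : Fin 2) :
    IsCohomologyBasis i (3 / 2) 1 ![C7 i] := by
  refine isCohomologyBasis_of (fun k => ?_) (fun r hr => ?_) fun d hd => ?_
  · fin_cases k
    exact C7_mem_cocycles i
  · obtain ⟨-, -, -, h3⟩ := eq_zero_of_mem_coboundaries_one (i := i) (lam := 3 / 2) (r := 0)
      (s := 0) (p := 0) (q := r 0) (by simpa using hr) fun _ => ⟨rfl, rfl⟩
    ext k; fin_cases k
    exact h3
  · obtain ⟨r, s, p, q, h, h0, hp, -⟩ := exists_sub_mem_coboundaries_one hd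
    rw [(h0 (by norm_num)).1, (h0 (by norm_num)).2, hp (by norm_num)] at h
    exact ⟨![q], by simpa using h⟩

theorem isCohomologyBasis_empty_one (i : Fin 2) {lam : ℝ} (h₀ : lam ≠ -1 / 2) (h₁ : lam ≠ 1 / 2)
    (h₂ : lam ≠ 3 / 2) : IsCohomologyBasis i lam 1 ![] := by
  refine isCohomologyBasis_of (fun k => k.elim0) (fun r _ => Subsingleton.elim _ _) fun d hd => ?_
  obtain ⟨r, s, p, q, h, h0, hp, hq⟩ := exists_sub_mem_coboundaries_one hd
  rw [(h0 h₀).1, (h0 h₀).2, hp h₁, hq h₂] at h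
  exact ⟨![], by simpa using h⟩

theorem proposition2 (i : Fin 2) :
    ((∀ lam : ℝ, Nonempty (H1 i lam 0 ≃ₗ[ℝ]
        (Fin (if lam = 0 then 3 else if lam = 1 then 1 else 0) → ℝ))) ∧
      IsCohomologyBasis i 0 0 ![C0 i, C1 i, C2 i] ∧
      IsCohomologyBasis i 1 0 ![C3 i]) ∧
    ((∀ lam : ℝ, Nonempty (H1 i lam 1 ≃ₗ[ℝ]
        (Fin (if lam = 1 / 2 ∨ lam = 3 / 2 then 1 else if lam = -1 / 2 then 2 else 0) → ℝ))) ∧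
      IsCohomologyBasis i (-1 / 2) 1 ![C4 i, C5 i] ∧
      IsCohomologyBasis i (1 / 2) 1 ![C6 i] ∧
      IsCohomologyBasis i (3 / 2) 1 ![C7 i]) := by
  refine ⟨⟨fun lam => ?_, isCohomologyBasis_zero_zero i, isCohomologyBasis_one_zero i⟩,
    fun lam => ?_, isCohomologyBasis_neg_half_one i, isCohomologyBasis_half_one i,
    isCohomologyBasis_three_halves_one i⟩
  · by_cases h0 : lam = 0
    · subst h0
      exact (isCohomologyBasis_zero_zero i).nonempty_equiv (by simp)
    by_cases h1 : lam = 1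
    · subst h1
      exact (isCohomologyBasis_one_zero i).nonempty_equiv (by simp)
    exact (isCohomologyBasis_empty_zero i h0 h1).nonempty_equiv (by simp [h0, h1])
  · by_cases h0 : lam = -1 / 2
    · subst h0
      exact (isCohomologyBasis_neg_half_one i).nonempty_equiv (by norm_num)
    by_cases h1 : lam = 1 / 2
    · subst h1
      exact (isCohomologyBasis_half_one i).nonempty_equiv (by norm_num)
    by_cases h2 : lam = 3 / 2
    · subst h2
      exact (isCohomologyBasis_three_halves_one i).nonempty_equiv (by norm_num)
    exact (isCohomologyBasis_empty_one i h0 h1 h2).nonempty_equiv (by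
      rw [if_neg (not_or.2 ⟨h1, h2⟩), if_neg h0])
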